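/- All graphs are finite and simple. A homeomorphically irreducible spanning tree (HIST) of a graph $G$ is a spanning tree of $G$ that has no vertex of degree $2$. The spectral radius $\rho(G)$ is the largest eigenvalue of the adjacency matrix of $G$. A graph is $2$-connected if it has at least three vertices, is connected, and stays connected after the deletion of any one vertex. For $n\ge 5$, let $B_n$ be the graph of order $n$ obtained from the disjoint union of a complete graph $K_{n-3}$ and a path $P_3$ on three vertices by joining the two ends of $P_3$ to two distinct vertices of $K_{n-3}$, one to each. Theorem. Let $n\ge 8$. (i) If $G$ is a $2$-connected graph of order $n$ with $\rho(G)\ge\rho(B_n)$, then $G$ has a HIST unless $G\cong B_n$; the exception is genuine: $B_n$ is $2$-connected and has no HIST. (ii) Consequently, $B_n$ uniquely maximises the spectral radius among the $2$-connected graphs of order $n$ without a HIST: every such graph $G$ satisfies $\rho(G)\le\rho(B_n)$, with equality if and only if $G\cong B_n$. -/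

import Mathlib

universe u

namespace HIST

open Classical in
/-- The spectral radius of a finite simple graph: the largest eigenvalue of its adjacency
matrix. The set of eigenvalues is finite, and non-empty as soon as the graph has a vertex. -/
noncomputable def spectralRadius {V : Type*} [Fintype V] (G : SimpleGraph V) : ℝ :=
  sSup {μ : ℝ | Module.End.HasEigenvalue (Matrix.toLin' (G.adjMatrix ℝ)) μ}

/-- A graph is 2-connected if it has at least three vertices, is connected, and stays connected
after the deletion of any one vertex. -/
def IsTwoConnected {V : Type*} [Fintype V] (G : SimpleGraph V) : Prop :=
  3 ≤ Fintype.card V ∧ G.Connected ∧ ∀ v : V, (G.induce {w : V | w ≠ v}).Connected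

/-- `G` has a homeomorphically irreducible spanning tree: a spanning tree without vertices of
degree 2. -/
def HasHIST {V : Type*} (G : SimpleGraph V) : Prop :=
  ∃ T : SimpleGraph V, T ≤ G ∧ T.IsTree ∧ ∀ v : V, (T.neighborSet v).ncard ≠ 2

/-- The graph `B_n` on the vertices `0, …, n - 1`, for `n ≥ 5`: the vertices `3, …, n - 1` form a
clique `K_{n-3}`, the vertices `0, 1, 2` form a path `0 - 1 - 2`, and the two ends `0` and `2` of
the path are joined to the vertices `3` and `4` of the clique, respectively.
(`SimpleGraph.fromRel` symmetrizes the relation and removes loops.) -/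
def graphB (n : ℕ) : SimpleGraph (Fin n) :=
  SimpleGraph.fromRel fun i j : Fin n =>
    (3 ≤ i.val ∧ 3 ≤ j.val) ∨
    (i.val = 0 ∧ j.val = 1) ∨ (i.val = 1 ∧ j.val = 2) ∨
    (i.val = 0 ∧ j.val = 3) ∨ (i.val = 2 ∧ j.val = 4)

end HIST

namespace HIST

open SimpleGraph Finset Matrix

set_option linter.unusedSectionVars false

/-! The spectral hypothesis is first turned into an edge count. Let m be the number of edges. If all
degrees are at least 2, every row sum of A² - A is at most 2m - 2(n - 1), and a nonnegative
eigenvector gives ρ² - ρ ≤ 2m - 2(n - 1) (`spectralRadius_bound`). A test vector gives ρ(B_n) > n -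
4 (`lt_spectralRadius_graphB`). By parity G then has at least C(n-3, 2) + 4 edges, the number of
edges of B_n. The combinatorial core is `IsTwoConnected.hasHIST_or_iso`: so many edges force a HIST
or B_n.

Let v have maximum degree N and let W be the set of the k vertices outside its closed neighbourhood;
the average degree forces k ≤ 5. A HIST is grown from a star by hanging at least two new leaves at a
time on a vertex of the tree (`Grows`), so that degree 2 never occurs. If G has no HIST, every local
configuration that lets such a tree absorb W is forbidden.

Let M be twice the number of non-adjacent pairs inside N(v). By `two_mul_edges` the edge count
bounds M above in terms of the links between N(v) and W and the edges inside W. Conversely,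
maximality of the degree of v makes M at least the number of links (`cov_le_coDeg`), and forbidden
configurations often isolate vertices inside N(v), which makes M large (`isolated_bound`). For k = 2
the two bounds meet only in B_n; for k = 1, 3, 4, 5 they clash, with two supplements. For k = 1 the
connectedness of G - v is used. For k = 3 with few links per vertex, M is too small for the
complement of G[N(v)] to connect certain vertices, so two adjacent ones dominate N(v)
(`exists_dominating_pair`) and a tree centred at one of them is used. -/

/-- The vertex sets of the subtrees of `G` that are obtained from a star with at least three leaves
by repeatedly joining at least two new vertices to a vertex of the tree. -/
inductive Grows {V : Type*} [DecidableEq V] (G : SimpleGraph V) : Finset V → Prop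
  | star (v : V) (D : Finset V) (hD : ∀ x ∈ D, G.Adj v x) (h3 : 3 ≤ #D) : Grows G (insert v D)
  | expand (S : Finset V) (u : V) (D : Finset V) (hS : Grows G S) (hu : u ∈ S)
      (hD : ∀ x ∈ D, G.Adj u x) (hd : Disjoint S D) (h2 : 2 ≤ #D) : Grows G (S ∪ D)

/-- `T` is a subtree of `G` with vertex set `S`, where acyclicity is expressed by a count of edges. -/
structure IsSubtreeOn {V : Type*} (G T : SimpleGraph V) (S : Finset V) : Prop where
  le : T ≤ G
  mem : ∀ x y, T.Adj x y → x ∈ S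
  reachable : ∀ x ∈ S, ∀ y ∈ S, T.Reachable x y
  card : T.edgeSet.ncard + 1 ≤ #S

/-! ### Growing subtrees without vertices of degree 2 -/

section Subtrees

variable {V : Type*} [Fintype V] [DecidableEq V] {G : SimpleGraph V}

/-- Hanging the vertices of `D` on `u` as leaves adds at most as many edges as vertices, and changes
the degrees of `u` and of the members of `D` only. -/
lemma IsSubtreeOn.join {T : SimpleGraph V} {S : Finset V} (h : IsSubtreeOn G T S) {u : V}
    (hu : u ∈ S) {D : Finset V} (hD : ∀ x ∈ D, G.Adj u x) (hd : Disjoint S D) :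
    ∃ T', IsSubtreeOn G T' (S ∪ D) ∧
      (T'.neighborSet u).ncard = (T.neighborSet u).ncard + #D ∧
      (∀ x ∈ D, (T'.neighborSet x).ncard = 1) ∧
      ∀ x, x ≠ u → x ∉ D → T'.neighborSet x = T.neighborSet x := by
  have hdis : ∀ x, x ∈ S → x ∉ D := fun x hx hx' => Finset.disjoint_left.1 hd hx hx'
  set T' : SimpleGraph V := T ⊔ SimpleGraph.fromRel (fun a b => a = u ∧ b ∈ D) with hT'
  have adj : ∀ a b, T'.Adj a b ↔ T.Adj a b ∨ (a = u ∧ b ∈ D) ∨ (b = u ∧ a ∈ D) := by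
    intro a b
    simp only [hT', SimpleGraph.sup_adj, SimpleGraph.fromRel_adj]
    constructor
    · tauto
    · rintro (h | ⟨rfl, h⟩ | ⟨rfl, h⟩)
      · exact Or.inl h
      · exact Or.inr ⟨fun e => hdis _ hu (e ▸ h), Or.inl ⟨rfl, h⟩⟩
      · exact Or.inr ⟨fun e => hdis _ hu (e ▸ h), Or.inr ⟨rfl, h⟩⟩
  have hmem2 : ∀ x y, T.Adj x y → y ∈ S := fun x y hxy => h.mem y x hxy.symm
  refine ⟨T', ⟨?_, ?_, ?_, ?_⟩, ?_, ?_, ?_⟩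
  · intro a b hab
    rcases (adj a b).1 hab with hab | ⟨rfl, hb⟩ | ⟨rfl, ha⟩
    · exact h.le hab
    · exact hD _ hb
    · exact (hD _ ha).symm
  · intro x y hxy
    rcases (adj x y).1 hxy with hxy | ⟨rfl, hb⟩ | ⟨rfl, ha⟩
    · exact mem_union_left _ (h.mem _ _ hxy)
    · exact mem_union_left _ hu
    · exact mem_union_right _ ha
  · have key : ∀ x ∈ S ∪ D, T'.Reachable u x := by
      intro x hx
      rcases mem_union.1 hx with hx | hx
      · exact (h.reachable u hu x hx).mono le_sup_left
      · exact SimpleGraph.Adj.reachable ((adj _ _).2 (Or.inr (Or.inl ⟨rfl, hx⟩)))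
    intro x hx y hy
    exact (key x hx).symm.trans (key y hy)
  · have hsub : T'.edgeSet ⊆ T.edgeSet ∪ ((D.image fun x => s(u, x) : Finset (Sym2 V)) : Set _) := by
      intro e
      induction e using Sym2.ind with
      | _ a b =>
        intro he
        rcases (adj a b).1 he with hab | ⟨rfl, hb⟩ | ⟨rfl, ha⟩
        · exact Or.inl hab
        · exact Or.inr (by simpa using ⟨b, hb, Or.inl rfl⟩)
        · exact Or.inr (by simpa using ⟨a, ha, Or.inr rfl⟩)
    have h1 := Set.ncard_le_ncard hsub (Set.toFinite _)
    have h2 := Set.ncard_union_le T.edgeSet ((D.image fun x => s(u, x) : Finset (Sym2 V)) : Set _)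
    rw [Set.ncard_coe_finset] at h2
    have h3 : #(D.image fun x => s(u, x)) ≤ #D := card_image_le
    have := h.card
    rw [card_union_of_disjoint hd]
    omega
  · have : T'.neighborSet u = T.neighborSet u ∪ (D : Set V) := by
      ext x
      simp only [mem_neighborSet, adj, Set.mem_union, mem_coe]
      have := hdis _ hu
      aesop
    rw [this, Set.ncard_union_eq, Set.ncard_coe_finset]
    rw [Set.disjoint_left]
    intro x hx hx'
    exact hdis x (hmem2 _ _ hx) hx'
  · intro x hx
    have : T'.neighborSet x = {u} := by
      ext y
      simp only [mem_neighborSet, adj, Set.mem_singleton_iff]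
      constructor
      · rintro (hxy | ⟨rfl, -⟩ | ⟨rfl, -⟩)
        · exact absurd hx (hdis _ (h.mem _ _ hxy))
        · exact absurd hx (hdis _ hu)
        · rfl
      · rintro rfl
        exact Or.inr (Or.inr ⟨rfl, hx⟩)
    rw [this, Set.ncard_singleton]
  · intro x hxu hxD
    ext y
    simp only [mem_neighborSet, adj]
    tauto

/-- Degrees on `S` are at least 1 throughout, so two or more new leaves lift the degree of `u` to at
least 3. -/
lemma Grows.exists_subtree {S : Finset V} (h : Grows G S) :
    ∃ T, IsSubtreeOn G T S ∧ (∀ x ∈ S, 1 ≤ (T.neighborSet x).ncard) ∧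
      ∀ x, (T.neighborSet x).ncard ≠ 2 := by
  induction h with
  | star v D hD h3 =>
    have hv : v ∉ D := fun hv => (hD v hv).ne rfl
    have h0 : IsSubtreeOn G ⊥ {v} :=
      ⟨bot_le, fun x y h => h.elim, by
        intro x hx y hy
        rw [mem_singleton.1 hx, mem_singleton.1 hy], by simp⟩
    obtain ⟨T, hT, h1, h2, h4⟩ := h0.join (mem_singleton_self v) hD (by simpa using hv)
    have e : ∀ x, ((⊥ : SimpleGraph V).neighborSet x).ncard = 0 := fun x => by simp
    rw [e] at h1
    refine ⟨T, hT, ?_, fun x => ?_⟩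
    · intro x hx
      rcases mem_insert.1 hx with rfl | hx
      · omega
      · rw [h2 x hx]
    · by_cases hxv : x = v
      · subst hxv; omega
      · by_cases hxD : x ∈ D
        · rw [h2 x hxD]; omega
        · rw [h4 x hxv hxD, e]; omega
  | expand S u D hS hu hD hd h2 ih =>
    obtain ⟨T, hT, hpos, hne⟩ := ih
    obtain ⟨T', hT', h1, h2', h4⟩ := hT.join hu hD hd
    have hupos := hpos u hu
    refine ⟨T', hT', ?_, fun x => ?_⟩
    · intro x hx
      by_cases hxu : x = u
      · subst hxu; omega
      · by_cases hxD : x ∈ D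
        · rw [h2' x hxD]
        · rw [h4 x hxu hxD]
          exact hpos x ((mem_union.1 hx).resolve_right hxD)
    · by_cases hxu : x = u
      · subst hxu; omega
      · by_cases hxD : x ∈ D
        · rw [h2' x hxD]; omega
        · rw [h4 x hxu hxD]; exact hne x

lemma Grows.hasHIST {S : Finset V} (h : Grows G S) (hS : ∀ x, x ∈ S) : HasHIST G := by
  obtain ⟨T, hT, hpos, hne⟩ := h.exists_subtree
  refine ⟨T, hT.le, ?_, hne⟩
  obtain rfl : S = univ := eq_univ_of_forall hS
  have hne : Nonempty V := by
    have := hT.card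
    rw [card_univ] at this
    exact Fintype.card_pos_iff.1 (by omega)
  have hconn : T.Connected := ⟨fun x y => hT.reachable x (mem_univ _) y (mem_univ _)⟩
  refine isTree_iff_connected_and_card.2 ⟨hconn, le_antisymm ?_ hconn.card_vert_le_card_edgeSet_add_one⟩
  have := hT.card
  rwa [card_univ, ← Nat.card_eq_fintype_card] at this

end Subtrees

/-! ### Counting edges around a vertex -/

section Local

variable {V : Type*} [Fintype V] [DecidableEq V] (G : SimpleGraph V) [DecidableRel G.Adj] (v : V)

/-- The vertices at distance at least two from `v`. -/
def nonNbrs : Finset V := {w | w ≠ v ∧ ¬G.Adj v w}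

/-- The number of neighbours of `u` among the vertices at distance at least two from `v`. -/
def cov (u : V) : ℕ := #{w ∈ nonNbrs G v | G.Adj u w}

/-- The number of non-neighbours of `u` among the neighbours of `v`. -/
def coDeg (u : V) : ℕ := #{x ∈ G.neighborFinset v | x ≠ u ∧ ¬G.Adj u x}

/-- The common neighbours of `v` and `w`. -/
def common (w : V) : Finset V := {u ∈ G.neighborFinset v | G.Adj w u}

variable {G v}

@[simp] lemma mem_nonNbrs {w : V} : w ∈ nonNbrs G v ↔ w ≠ v ∧ ¬G.Adj v w := by simp [nonNbrs]

@[simp] lemma mem_common {u w : V} : u ∈ common G v w ↔ G.Adj v u ∧ G.Adj w u := by simp [common]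

lemma common_subset (w : V) : common G v w ⊆ G.neighborFinset v := filter_subset _ _

variable (G v) in
lemma card_eq_degree_add : Fintype.card V = G.degree v + 1 + #(nonNbrs G v) := by
  have : (univ : Finset V) = insert v (G.neighborFinset v) ∪ nonNbrs G v := by
    ext x
    by_cases hx : x = v <;> by_cases hx' : G.Adj v x <;> simp [hx, hx']
  rw [← card_univ, this, card_union_of_disjoint, card_insert_of_notMem, card_neighborFinset_eq_degree]
  · simp
  · rw [Finset.disjoint_left]
    intro x hx
    rw [mem_insert, mem_neighborFinset] at hx
    simp only [mem_nonNbrs]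
    tauto

lemma degree_add_coDeg {u : V} (hu : G.Adj v u) :
    G.degree u + coDeg G v u = cov G v u + G.degree v := by
  have h1 : G.neighborFinset u = insert v {x ∈ G.neighborFinset v | G.Adj u x} ∪
      {w ∈ nonNbrs G v | G.Adj u w} := by
    ext x
    by_cases hx : x = v
    · subst hx; simp [hu.symm]
    · by_cases hx' : G.Adj v x <;> simp [hx, hx']
  have h2 : G.neighborFinset v = insert u {x ∈ G.neighborFinset v | G.Adj u x} ∪
      {x ∈ G.neighborFinset v | x ≠ u ∧ ¬G.Adj u x} := by
    ext x
    by_cases hx : x = u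
    · subst hx; simp [hu]
    · by_cases hx' : G.Adj u x <;> simp [hx, hx']
  have c1 : G.degree u = #{x ∈ G.neighborFinset v | G.Adj u x} + 1 + cov G v u := by
    rw [← card_neighborFinset_eq_degree, h1, card_union_of_disjoint, card_insert_of_notMem, cov]
    · simp
    · rw [Finset.disjoint_left]
      intro x hx
      simp only [mem_insert, mem_filter, mem_neighborFinset, mem_nonNbrs] at hx ⊢
      tauto
  have c2 : G.degree v = #{x ∈ G.neighborFinset v | G.Adj u x} + 1 + coDeg G v u := by
    rw [← card_neighborFinset_eq_degree]
    conv_lhs => rw [h2]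
    rw [card_union_of_disjoint, card_insert_of_notMem, coDeg]
    · simp
    · rw [Finset.disjoint_left]
      intro x hx
      simp only [mem_insert, mem_filter, mem_neighborFinset] at hx ⊢
      tauto
  omega

lemma degree_nonNbr {w : V} (hw : w ∈ nonNbrs G v) :
    G.degree w = #(common G v w) + cov G v w := by
  have hw' := mem_nonNbrs.1 hw
  have h1 : G.neighborFinset w = common G v w ∪ {x ∈ nonNbrs G v | G.Adj w x} := by
    ext x
    by_cases hx : x = v
    · subst hx; simpa using fun h : G.Adj w x => hw'.2 h.symm
    · by_cases hx' : G.Adj v x <;> simp [hx, hx']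
  rw [← card_neighborFinset_eq_degree, h1, card_union_of_disjoint, cov]
  rw [Finset.disjoint_left]
  intro x hx
  simp only [mem_common, mem_filter, mem_nonNbrs] at hx ⊢
  tauto

variable (G v) in
lemma sum_cov_eq : ∑ u ∈ G.neighborFinset v, cov G v u = ∑ w ∈ nonNbrs G v, #(common G v w) := by
  have := sum_card_bipartiteAbove_eq_sum_card_bipartiteBelow (s := G.neighborFinset v)
    (t := nonNbrs G v) (fun u w => G.Adj u w)
  simp only [bipartiteAbove, bipartiteBelow] at this
  simp only [cov, common, this, G.adj_comm]

variable (G v) in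
-- The sum of `coDeg` is twice the number of non-adjacent pairs inside the neighbourhood of `v`, and
-- the sum of `cov` over `nonNbrs` is twice the number of edges there. A lower bound on the edges of
-- `G` thus becomes an upper bound on missing pairs; this is the form of `hm` in the case lemmas.
lemma two_mul_edges : 2 * #G.edgeFinset + ∑ u ∈ G.neighborFinset v, coDeg G v u =
    G.degree v + G.degree v * G.degree v + 2 * ∑ w ∈ nonNbrs G v, #(common G v w) +
      ∑ w ∈ nonNbrs G v, cov G v w := by
  have hu : (univ : Finset V) = insert v (G.neighborFinset v) ∪ nonNbrs G v := by
    ext x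
    by_cases hx : x = v <;> by_cases hx' : G.Adj v x <;> simp [hx, hx']
  have h1 : ∑ u ∈ G.neighborFinset v, G.degree u + ∑ u ∈ G.neighborFinset v, coDeg G v u =
      ∑ u ∈ G.neighborFinset v, cov G v u + G.degree v * G.degree v := by
    rw [← sum_add_distrib, sum_congr rfl fun u hu => degree_add_coDeg ((mem_neighborFinset ..).1 hu),
      sum_add_distrib, sum_const, card_neighborFinset_eq_degree, smul_eq_mul]
  have h2 : ∑ w ∈ nonNbrs G v, G.degree w =
      ∑ w ∈ nonNbrs G v, #(common G v w) + ∑ w ∈ nonNbrs G v, cov G v w := by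
    rw [← sum_add_distrib]
    exact sum_congr rfl fun w hw => degree_nonNbr hw
  rw [← sum_degrees_eq_twice_card_edges, hu, sum_union, sum_insert, h2]
  · rw [sum_cov_eq] at h1
    omega
  · simp
  · rw [Finset.disjoint_left]
    intro x hx
    simp only [mem_insert, mem_neighborFinset, mem_nonNbrs] at hx ⊢
    tauto

/-- A set of `s` isolated vertices of the graph induced on the neighbours of `v`, together with
another vertex `u`, forces many non-adjacent pairs. -/
lemma isolated_bound {S : Finset V} (hS : S ⊆ G.neighborFinset v)
    (hiso : ∀ x ∈ S, ∀ y, G.Adj v y → ¬G.Adj x y) {u : V} (hu : G.Adj v u) (huS : u ∉ S) :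
    2 * #S * G.degree v + 2 * coDeg G v u ≤
      ∑ x ∈ G.neighborFinset v, coDeg G v x + #S * #S + 3 * #S := by
  set N := G.neighborFinset v with hN
  have hNc : #N = G.degree v := card_neighborFinset_eq_degree ..
  have hSu : insert u S ⊆ N := insert_subset (by simpa [hN] using hu) hS
  have hcard : #(insert u S) = #S + 1 := card_insert_of_notMem huS
  have hle : #S + 1 ≤ G.degree v := by rw [← hNc, ← hcard]; exact card_le_card hSu
  have hSiso : ∀ x ∈ S, coDeg G v x + 1 = G.degree v := by
    intro x hx
    have : {y ∈ N | y ≠ x ∧ ¬G.Adj x y} = N.erase x := by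
      ext y
      have := hiso x hx y
      simp only [hN, mem_filter, mem_neighborFinset, mem_erase]
      tauto
    rw [coDeg, ← hN, this, card_erase_of_mem (hS hx), hNc]
    omega
  -- Every remaining neighbour of `v` misses all of `S`, and `u` too if not adjacent to it. The
  -- latter terms, summed, recover `coDeg G v u` up to `#S`, whence its factor 2.
  have hrest : ∀ x ∈ N \ insert u S, #S + (if G.Adj u x then 0 else 1) ≤ coDeg G v x := by
    intro x hx
    simp only [mem_sdiff, mem_insert, not_or] at hx
    have hxv : G.Adj v x := by simpa [hN] using hx.1
    split_ifs with h
    · rw [add_zero]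
      refine card_le_card fun y hy => ?_
      simp only [mem_filter]
      refine ⟨hS hy, fun e => hx.2.2 (e ▸ hy), fun e => hiso y hy x hxv e.symm⟩
    · rw [← hcard]
      refine card_le_card fun y hy => ?_
      simp only [mem_filter]
      refine ⟨hSu hy, ?_⟩
      rcases mem_insert.1 hy with rfl | hy
      · exact ⟨fun e => hx.2.1 e.symm, fun e => h e.symm⟩
      · exact ⟨fun e => hx.2.2 (e ▸ hy), fun e => hiso y hy x hxv e.symm⟩
  have hco : coDeg G v u ≤ #S + ∑ x ∈ N \ insert u S, (if G.Adj u x then 0 else 1) := by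
    have e : ∑ x ∈ N \ insert u S, (if G.Adj u x then 0 else 1) =
        #{x ∈ N \ insert u S | ¬G.Adj u x} := by
      rw [card_filter]
      exact sum_congr rfl fun x _ => by split_ifs <;> simp_all
    rw [e]
    refine (card_le_card ?_).trans (card_union_le _ _)
    intro x hx
    simp only [mem_filter, mem_union, mem_sdiff, mem_insert] at hx ⊢
    tauto
  have hsum : ∑ x ∈ N, coDeg G v x = ∑ x ∈ N \ insert u S, coDeg G v x + coDeg G v u +
      ∑ x ∈ S, coDeg G v x := by
    rw [← sum_sdiff hSu, sum_insert huS, add_assoc]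
  have h1 : ∑ x ∈ S, coDeg G v x + #S = #S * G.degree v := by
    have : ∑ x ∈ S, (coDeg G v x + 1) = ∑ x ∈ S, G.degree v := sum_congr rfl hSiso
    simpa [sum_add_distrib] using this
  have h2 := sum_le_sum hrest
  rw [sum_add_distrib, sum_const, smul_eq_mul, card_sdiff_of_subset hSu, hcard, hNc] at h2
  obtain ⟨r, hr⟩ := Nat.exists_eq_add_of_le hle
  rw [hr] at h1 h2 ⊢
  rw [Nat.add_sub_cancel_left] at h2
  rw [hsum]
  nlinarith

lemma card_le_coDeg {S : Finset V} (hS : S ⊆ G.neighborFinset v)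
    (hiso : ∀ x ∈ S, ∀ y, G.Adj v y → ¬G.Adj x y) {u : V} (hu : G.Adj v u) (huS : u ∉ S) :
    #S ≤ coDeg G v u :=
  card_le_card fun y hy => by
    simp only [mem_filter]
    exact ⟨hS hy, fun e => huS (e ▸ hy), fun e => hiso y hy u hu e.symm⟩

lemma isolated_bound' {S : Finset V} (hS : S ⊆ G.neighborFinset v)
    (hiso : ∀ x ∈ S, ∀ y, G.Adj v y → ¬G.Adj x y) :
    2 * #S * G.degree v ≤ ∑ x ∈ G.neighborFinset v, coDeg G v x + #S * #S + #S := by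
  by_cases h : ∃ u, G.Adj v u ∧ u ∉ S
  · obtain ⟨u, hu, huS⟩ := h
    have := isolated_bound hS hiso hu huS
    have := card_le_coDeg hS hiso hu huS
    omega
  -- Here the neighbourhood of `v` is `S` itself, an independent set.
  · push Not at h
    have hSN : S = G.neighborFinset v :=
      subset_antisymm hS fun x hx => h x ((mem_neighborFinset ..).1 hx)
    have hSiso : ∀ x ∈ S, coDeg G v x + 1 = G.degree v := by
      intro x hx
      have : {y ∈ G.neighborFinset v | y ≠ x ∧ ¬G.Adj x y} = (G.neighborFinset v).erase x := by
        ext y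
        have := hiso x hx y
        simp only [mem_filter, mem_neighborFinset, mem_erase]
        tauto
      have hx' := hS hx
      have hp : 0 < #(G.neighborFinset v) := card_pos.2 ⟨x, hx'⟩
      rw [coDeg, this, card_erase_of_mem hx']
      rw [card_neighborFinset_eq_degree] at hp ⊢
      omega
    have : ∑ x ∈ S, (coDeg G v x + 1) = ∑ x ∈ S, G.degree v := sum_congr rfl hSiso
    rw [sum_add_distrib, sum_const, sum_const] at this
    have hc : #S = G.degree v := by rw [hSN, card_neighborFinset_eq_degree]
    rw [← hSN]
    simp only [smul_eq_mul, mul_one] at this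
    rw [hc] at this ⊢
    nlinarith

lemma two_mul_coDeg_le {u : V} (hu : G.Adj v u) :
    2 * coDeg G v u ≤ ∑ x ∈ G.neighborFinset v, coDeg G v x := by
  simpa using isolated_bound (S := ∅) (by simp) (by simp) hu (by simp)

end Local

/-! ### Configurations that yield a HIST, grown from a star at `v` -/

section Trees

variable {V : Type*} [Fintype V] [DecidableEq V] {G : SimpleGraph V} [DecidableRel G.Adj] {v : V}

lemma Grows.pair {S : Finset V} (h : Grows G S) {u x y : V} (hu : u ∈ S) (hx : G.Adj u x)
    (hy : G.Adj u y) (hxS : x ∉ S) (hyS : y ∉ S) (hxy : x ≠ y) : Grows G (S ∪ {x, y}) := by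
  refine h.expand _ u _ hu ?_ ?_ (by rw [card_pair hxy])
  · simp [hx, hy]
  · simp [hxS, hyS]

/-- The vertices of `X` are withheld from the star, to serve later as second leaves elsewhere. -/
lemma grows_star_sdiff {X : Finset V} (h : 3 + #X ≤ G.degree v) :
    Grows G (insert v (G.neighborFinset v \ X)) := by
  refine .star v _ (by simp +contextual) ?_
  have := le_card_sdiff X (G.neighborFinset v)
  rw [card_neighborFinset_eq_degree] at this
  omega

lemma Grows.hasHIST_of_parts {S : Finset V} (g : Grows G S) (hv : v ∈ S)
    (hN : ∀ x, G.Adj v x → x ∈ S) (hW : ∀ x ∈ nonNbrs G v, x ∈ S) : HasHIST G := by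
  refine g.hasHIST fun x => ?_
  by_cases hx : x = v
  · exact hx ▸ hv
  · by_cases hx' : G.Adj v x
    · exact hN x hx'
    · exact hW x (mem_nonNbrs.2 ⟨hx, hx'⟩)

lemma hasHIST_of_cov_all (hN : 3 ≤ G.degree v) (hW : 2 ≤ #(nonNbrs G v)) {u : V} (hu : G.Adj v u)
    (hcov : ∀ w ∈ nonNbrs G v, G.Adj u w) : HasHIST G := by
  have g := (grows_star_sdiff (G := G) (v := v) (X := ∅) (by simpa)).expand _ u (nonNbrs G v)
    (by simp [hu]) hcov (by simp [Finset.disjoint_left]; tauto) hW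
  refine g.hasHIST_of_parts (v := v) (by simp) (by simp +contextual) (by simp +contextual)

/-- With `x` withheld from the star, `u'` takes `w` and `x`, then `u` takes the rest of `nonNbrs`.
This order also covers `u = x`. -/
lemma hasHIST_of_cov_erase (hN : 4 ≤ G.degree v) (hW : 3 ≤ #(nonNbrs G v)) {u : V} (hu : G.Adj v u)
    {w : V} (hw : w ∈ nonNbrs G v) (hcov : ∀ w' ∈ nonNbrs G v, w' ≠ w → G.Adj u w')
    {u' x : V} (hu' : G.Adj v u') (hu'w : G.Adj u' w) (hx : G.Adj v x) (hu'x : G.Adj u' x) :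
    HasHIST G := by
  by_cases huw : G.Adj u w
  · refine hasHIST_of_cov_all (by omega) (by omega) hu fun w' hw' => ?_
    by_cases h : w' = w
    · exact h ▸ huw
    · exact hcov w' hw' h
  have hwv := mem_nonNbrs.1 hw
  have g0 := grows_star_sdiff (G := G) (v := v) (X := {x}) (by simpa)
  have g1 := g0.pair (u := u') (by simp [hu', hu'x.ne]) hu'w hu'x (by simp [hwv]) (by simp [hx.ne'])
    (by rintro rfl; exact hwv.2 hx)
  have g2 := g1.expand _ u ((nonNbrs G v).erase w) ?_ ?_ ?_ ?_
  · refine g2.hasHIST_of_parts (v := v) (by simp) ?_ ?_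
    · intro y hy; by_cases h : y = x <;> simp [h, hy]
    · intro y hy; by_cases h : y = w <;> simp_all
  · by_cases h : u = x <;> simp [h, hu]
  · intro y hy
    exact hcov y (mem_of_mem_erase hy) (ne_of_mem_erase hy)
  · rw [Finset.disjoint_left]
    intro y hy
    simp only [mem_union, mem_insert, mem_sdiff, mem_neighborFinset, mem_singleton, mem_erase,
      mem_nonNbrs] at hy ⊢
    rintro ⟨h1, h2, h3⟩
    rcases hy with (rfl | h) | rfl | rfl <;> tauto
  · rw [card_erase_of_mem hw]; omega

/-- With `x` withheld, `u` takes all of `nonNbrs` but `w`, and then `w'` takes `w` and `x`. -/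
lemma hasHIST_of_cov_erase_adj (hN : 4 ≤ G.degree v) (hW : 3 ≤ #(nonNbrs G v)) {u : V}
    (hu : G.Adj v u) {w : V} (hw : w ∈ nonNbrs G v)
    (hcov : ∀ w' ∈ nonNbrs G v, w' ≠ w → G.Adj u w')
    {w' x : V} (hw' : w' ∈ nonNbrs G v) (hww' : G.Adj w' w) (hx : G.Adj v x) (hxu : x ≠ u)
    (hw'x : G.Adj w' x) : HasHIST G := by
  have hwv := mem_nonNbrs.1 hw
  have hwv' := mem_nonNbrs.1 hw'
  have g0 := grows_star_sdiff (G := G) (v := v) (X := {x}) (by simpa)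
  have g1 := g0.expand _ u ((nonNbrs G v).erase w) (by simp [hu, hxu.symm])
    (fun y hy => hcov y (mem_of_mem_erase hy) (ne_of_mem_erase hy))
    (by
      simp only [Finset.disjoint_left, mem_insert, mem_sdiff, mem_neighborFinset, mem_singleton,
        mem_erase, mem_nonNbrs]
      tauto)
    (by rw [card_erase_of_mem hw]; omega)
  have hwx : w ≠ x := by rintro rfl; exact hwv.2 hx
  have g2 := g1.pair (u := w') (by simp [hwv', hww'.ne]) hww' hw'x (by simp [hwv])
    (by simp [hx.ne', hx]) hwx
  refine g2.hasHIST_of_parts (v := v) (by simp) ?_ ?_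
  · intro y hy; by_cases h : y = x <;> simp [h, hy]
  · intro y hy; by_cases h : y = w <;> simp_all

/-- With four vertices in `nonNbrs`, `u` can leave both `w` and `x` to `w'` and still take two. -/
lemma hasHIST_of_cov_erase_adj_adj (hN : 3 ≤ G.degree v) (hW : 4 ≤ #(nonNbrs G v)) {u : V}
    (hu : G.Adj v u) {w : V} (hw : w ∈ nonNbrs G v)
    (hcov : ∀ w' ∈ nonNbrs G v, w' ≠ w → G.Adj u w')
    {w' x : V} (hw' : w' ∈ nonNbrs G v) (hww' : G.Adj w' w) (hx : x ∈ nonNbrs G v) (hxw : x ≠ w)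
    (hw'x : G.Adj w' x) : HasHIST G := by
  have hwv := mem_nonNbrs.1 hw
  have hwv' := mem_nonNbrs.1 hw'
  have hxv := mem_nonNbrs.1 hx
  have g0 := grows_star_sdiff (G := G) (v := v) (X := ∅) (by simpa)
  have g1 := g0.expand _ u (((nonNbrs G v).erase w).erase x) (by simp [hu])
    (fun y hy => hcov y (mem_of_mem_erase (mem_of_mem_erase hy))
      (ne_of_mem_erase (mem_of_mem_erase hy)))
    (by
      simp only [Finset.disjoint_left, mem_insert, mem_sdiff, mem_neighborFinset, notMem_empty,
        mem_erase, mem_nonNbrs]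
      tauto)
    (by rw [card_erase_of_mem (by simp [hxw, hxv]), card_erase_of_mem hw]; omega)
  have g2 := g1.pair (u := w') (by simp [hwv', hww'.ne, hw'x.ne]) hww' hw'x (by simp [hwv])
    (by simp [hxv]) hxw.symm
  refine g2.hasHIST_of_parts (v := v) (by simp) ?_ ?_
  · intro y hy; simp [hy]
  · intro y hy; by_cases h : y = w <;> by_cases h' : y = x <;> simp_all

/-- `u₁` takes `w₁` and `x₁`, then `u₂` takes `w₂` and `x₂`. In this order `u₂ = x₁` is harmless,
whereas `u₁` must lie in the initial star, hence `hxu`. -/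
lemma hasHIST_of_two {w₁ w₂ : V} (hW : nonNbrs G v = {w₁, w₂}) (h12 : w₁ ≠ w₂) (hN : 5 ≤ G.degree v)
    {u₁ u₂ x₁ x₂ : V} (hu₁ : G.Adj v u₁) (hu₂ : G.Adj v u₂) (hx₁ : G.Adj v x₁) (hx₂ : G.Adj v x₂)
    (hw₁ : G.Adj u₁ w₁) (hw₂ : G.Adj u₂ w₂) (h₁ : G.Adj u₁ x₁) (h₂ : G.Adj u₂ x₂) (hx : x₁ ≠ x₂)
    (hxu : x₂ ≠ u₁) : HasHIST G := by
  have a1 : w₁ ≠ v ∧ ¬G.Adj v w₁ := by rw [← mem_nonNbrs, hW]; simp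
  have a2 : w₂ ≠ v ∧ ¬G.Adj v w₂ := by rw [← mem_nonNbrs, hW]; simp
  have g0 := grows_star_sdiff (G := G) (v := v) (X := {x₁, x₂}) (by rw [card_pair hx]; omega)
  have g1 := g0.pair (u := u₁) (by simp [hu₁, h₁.ne, hxu.symm]) hw₁ h₁ (by simp [a1])
    (by simp [hx₁.ne']) (by rintro rfl; tauto)
  have g2 := g1.pair (u := u₂) (by by_cases h : u₂ = x₁ <;> simp [hu₂, h₂.ne, h]) hw₂ h₂
    (by simp [a2, h12.symm]; rintro rfl; tauto)
    (by simp [hx₂.ne', hx.symm]; rintro rfl; tauto) (by rintro rfl; tauto)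
  refine g2.hasHIST_of_parts (v := v) (by simp) ?_ ?_
  · intro y hy; by_cases h : y = x₁ <;> by_cases h' : y = x₂ <;> simp [h, h', hy]
  · intro y hy; rw [hW] at hy; simp at hy; rcases hy with rfl | rfl <;> simp

/-- `u` takes `w₁` and `x`, then `w₁` takes `w₂` and its second common neighbour `u'`. -/
lemma hasHIST_of_two_adj {w₁ w₂ : V} (hW : nonNbrs G v = {w₁, w₂}) (hw : G.Adj w₁ w₂)
    (hN : 5 ≤ G.degree v) {u u' x : V} (hu : G.Adj v u) (hu' : G.Adj v u') (hx : G.Adj v x)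
    (hwu : G.Adj w₁ u) (hwu' : G.Adj w₁ u') (hux : G.Adj u x) (huu' : u ≠ u') (hxu' : x ≠ u') :
    HasHIST G := by
  have a1 : w₁ ≠ v ∧ ¬G.Adj v w₁ := by rw [← mem_nonNbrs, hW]; simp
  have a2 : w₂ ≠ v ∧ ¬G.Adj v w₂ := by rw [← mem_nonNbrs, hW]; simp
  have g0 := grows_star_sdiff (G := G) (v := v) (X := {x, u'}) (by rw [card_pair hxu']; omega)
  have g1 := g0.pair (u := u) (by simp [hu, hux.ne, huu']) hwu.symm hux (by simp [a1])
    (by simp [hx.ne']) (by rintro rfl; tauto)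
  have g2 := g1.pair (u := w₁) (by simp) hw hwu'
    (by simp [a2, hw.ne']; rintro rfl; tauto)
    (by simp [hu'.ne', hxu'.symm]; rintro rfl; tauto) (by rintro rfl; tauto)
  refine g2.hasHIST_of_parts (v := v) (by simp) ?_ ?_
  · intro y hy; by_cases h : y = x <;> by_cases h' : y = u' <;> simp [h, h', hy]
  · intro y hy; rw [hW] at hy; simp at hy; rcases hy with rfl | rfl <;> simp

/-- `u` takes `w₁` and `x`, then `w₁` takes `w₂` and `w₃`. -/
lemma hasHIST_of_center {w₁ w₂ w₃ : V} (hW : nonNbrs G v = {w₁, w₂, w₃}) (h23 : w₂ ≠ w₃)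
    (h12 : G.Adj w₁ w₂) (h13 : G.Adj w₁ w₃) (hN : 4 ≤ G.degree v) {u x : V} (hu : G.Adj v u)
    (hwu : G.Adj w₁ u) (hx : G.Adj v x) (hux : G.Adj u x) : HasHIST G := by
  have a1 : w₁ ≠ v ∧ ¬G.Adj v w₁ := by rw [← mem_nonNbrs, hW]; simp
  have a2 : w₂ ≠ v ∧ ¬G.Adj v w₂ := by rw [← mem_nonNbrs, hW]; simp
  have a3 : w₃ ≠ v ∧ ¬G.Adj v w₃ := by rw [← mem_nonNbrs, hW]; simp
  have g0 := grows_star_sdiff (G := G) (v := v) (X := {x}) (by simpa)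
  have g1 := g0.pair (u := u) (by simp [hu, hux.ne]) hwu.symm hux (by simp [a1])
    (by simp [hx.ne']) (by rintro rfl; tauto)
  have g2 := g1.pair (u := w₁) (by simp) h12 h13
    (by simp [a2, h12.ne']; rintro rfl; tauto)
    (by simp [a3, h13.ne']; rintro rfl; tauto) h23
  refine g2.hasHIST_of_parts (v := v) (by simp) ?_ ?_
  · intro y hy; by_cases h : y = x <;> simp [h, hy]
  · intro y hy; rw [hW] at hy; simp at hy; rcases hy with rfl | rfl | rfl <;> simp

/-- `u` takes `w₁` and `w₂`, then `w₁` takes `w₃` and `w₄`. -/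
lemma hasHIST_of_four {w₁ w₂ w₃ w₄ : V} (hW : nonNbrs G v = {w₁, w₂, w₃, w₄}) (h12 : w₁ ≠ w₂)
    (h23 : w₂ ≠ w₃) (h24 : w₂ ≠ w₄) (h34 : w₃ ≠ w₄) (h13 : G.Adj w₁ w₃) (h14 : G.Adj w₁ w₄)
    (hN : 3 ≤ G.degree v) {u : V} (hu : G.Adj v u) (hw₁ : G.Adj u w₁) (hw₂ : G.Adj u w₂) :
    HasHIST G := by
  have a1 : w₁ ≠ v ∧ ¬G.Adj v w₁ := by rw [← mem_nonNbrs, hW]; simp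
  have a2 : w₂ ≠ v ∧ ¬G.Adj v w₂ := by rw [← mem_nonNbrs, hW]; simp
  have a3 : w₃ ≠ v ∧ ¬G.Adj v w₃ := by rw [← mem_nonNbrs, hW]; simp
  have a4 : w₄ ≠ v ∧ ¬G.Adj v w₄ := by rw [← mem_nonNbrs, hW]; simp
  have g0 := grows_star_sdiff (G := G) (v := v) (X := ∅) (by simpa)
  have g1 := g0.pair (u := u) (by simp [hu]) hw₁ hw₂ (by simp [a1]) (by simp [a2]) h12
  have g2 := g1.pair (u := w₁) (by simp) h13 h14 (by simp [a3, h13.ne', h23.symm])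
    (by simp [a4, h14.ne', h24.symm]) h34
  refine g2.hasHIST_of_parts (v := v) (by simp) ?_ ?_
  · intro y hy; simp [hy]
  · intro y hy; rw [hW] at hy; simp at hy; rcases hy with rfl | rfl | rfl | rfl <;> simp

end Trees

/-! ### Trees built on an adjacent pair that dominates the neighbourhood of `v` -/

section FarPair

variable {V : Type*} [Fintype V] [DecidableEq V] {G : SimpleGraph V} [DecidableRel G.Adj] {v : V}

/-- The tree is centred at `p`, not at `v`: `p` and `r` share the neighbours of `v` other than `q`,
while `w₂` takes `w₁` and `q`. Only the place of `v`, below `p` or below `r`, depends on the case.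
-/
lemma hasHIST_of_dominating_pendant {w₁ w₂ w₃ : V} (hW : nonNbrs G v = {w₁, w₂, w₃}) (h13 : w₁ ≠ w₃)
    (h23 : w₂ ≠ w₃) (h12 : G.Adj w₁ w₂) (hN : 4 ≤ G.degree v) {p q r : V} (hp : G.Adj v p)
    (hq : G.Adj v q) (hr : G.Adj v r) (hpq : p ≠ q) (hqr : q ≠ r) (hpr : G.Adj p r)
    (hwp : G.Adj w₂ p) (hwq : G.Adj w₂ q) (hwr : G.Adj w₃ r)
    (hdom : ∀ x, G.Adj v x → x ≠ p → x ≠ r → G.Adj p x ∨ G.Adj r x) : HasHIST G := by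
  have a1 : w₁ ≠ v ∧ ¬G.Adj v w₁ := by rw [← mem_nonNbrs, hW]; simp
  have a2 : w₂ ≠ v ∧ ¬G.Adj v w₂ := by rw [← mem_nonNbrs, hW]; simp
  have a3 : w₃ ≠ v ∧ ¬G.Adj v w₃ := by rw [← mem_nonNbrs, hW]; simp
  have nw : ∀ {w x : V}, ¬G.Adj v w → G.Adj v x → w ≠ x := by rintro w x h h' rfl; exact h h'
  set R := G.neighborFinset v \ {p, q, r} with hR
  have hRmem : ∀ x, x ∈ R ↔ G.Adj v x ∧ x ≠ p ∧ x ≠ q ∧ x ≠ r := by simp [hR]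
  have hRne : R.Nonempty := by
    rw [← card_pos]
    have h1 := le_card_sdiff {p, q, r} (G.neighborFinset v)
    have h2 : #({p, q, r} : Finset V) ≤ 3 := card_le_three
    rw [card_neighborFinset_eq_degree, ← hR] at h1
    omega
  by_cases hX : ∃ s ∈ R, G.Adj r s
  · obtain ⟨s, hs, hrs⟩ := hX
    have g0 : Grows G (insert p ({w₂, r, v} ∪ {x ∈ R | ¬G.Adj r x})) := by
      refine .star p _ ?_ ?_
      · intro x hx
        simp only [mem_union, mem_insert, mem_singleton, mem_filter, hRmem] at hx
        rcases hx with (rfl | rfl | rfl) | ⟨h, h'⟩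
        · exact hwp.symm
        · exact hpr
        · exact hp.symm
        · exact (hdom x h.1 h.2.1 h.2.2.2).resolve_right h'
      · refine le_trans ?_ (card_le_card subset_union_left)
        rw [card_eq_three.2 ⟨w₂, r, v, nw a2.2 hr, a2.1, hr.ne', rfl⟩]
    have g1 := g0.pair (u := w₂) (by simp) h12.symm hwq
      (by simp [nw a1.2 hp, nw a1.2 hr, a1.1, h12.ne, hRmem, a1.2])
      (by simp [hpq.symm, hqr, hq.ne', (nw a2.2 hq).symm, hRmem]) (nw a1.2 hq)
    have g2 := g1.expand _ r (insert w₃ {x ∈ R | G.Adj r x}) (by simp)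
      (by simp only [mem_insert, mem_filter]; rintro x (rfl | h); exacts [hwr.symm, h.2])
      (by
        rw [Finset.disjoint_right]
        simp only [mem_insert, mem_filter, mem_union, mem_singleton, hRmem]
        rintro x (rfl | ⟨⟨h1, h2, h3, h4⟩, h5⟩)
        · simp [nw a3.2 hp, nw a3.2 hr, nw a3.2 hq, a3, h13.symm, h23.symm]
        · simp [h2, h3, h4, h5, h1.ne', (nw a2.2 h1).symm, (nw a1.2 h1).symm])
      (by
        refine le_trans ?_ (card_le_card (s := {w₃, s}) ?_)
        · rw [card_pair (nw a3.2 ((hRmem s).1 hs).1)]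
        · simp [insert_subset_iff, hs, hrs])
    refine g2.hasHIST_of_parts (v := v) (by simp) ?_ ?_
    · intro x hx
      by_cases h1 : x = p <;> by_cases h2 : x = q <;> by_cases h3 : x = r <;>
        by_cases h4 : G.Adj r x <;> simp [h1, h2, h3, h4, hRmem, hx]
    · rw [hW]; simp
  -- Now `p` alone dominates `R`, which is nonempty, so `p` can spare `v`; it becomes the second
  -- leaf of `r`, next to `w₃`.
  · push Not at hX
    obtain ⟨s, hs⟩ := hRne
    have g0 : Grows G (insert p ({w₂, r} ∪ R)) := by
      refine .star p _ ?_ ?_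
      · intro x hx
        simp only [mem_union, mem_insert, mem_singleton] at hx
        rcases hx with (rfl | rfl) | hx
        · exact hwp.symm
        · exact hpr
        · have h := (hRmem x).1 hx
          exact (hdom x h.1 h.2.1 h.2.2.2).resolve_right (hX x hx)
      · have h := (hRmem s).1 hs
        refine le_trans ?_ (card_le_card (s := {w₂, r, s}) ?_)
        · rw [card_eq_three.2 ⟨w₂, r, s, nw a2.2 hr, nw a2.2 h.1, h.2.2.2.symm, rfl⟩]
        · simp [insert_subset_iff, hs]
    have g1 := g0.pair (u := w₂) (by simp) h12.symm hwq
      (by simp [nw a1.2 hp, nw a1.2 hr, h12.ne, hRmem, a1.2])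
      (by simp [hpq.symm, hqr, (nw a2.2 hq).symm, hRmem]) (nw a1.2 hq)
    have g2 := g1.pair (u := r) (by simp) hwr.symm hr.symm
      (by simp [nw a3.2 hp, nw a3.2 hr, nw a3.2 hq, a3, h13.symm, h23.symm, hRmem])
      (by simp [hp.ne, hr.ne, hq.ne, a1.1.symm, a2.1.symm, hRmem]) a3.1
    refine g2.hasHIST_of_parts (v := v) (by simp) ?_ ?_
    · intro x hx
      by_cases h1 : x = p <;> by_cases h2 : x = q <;> by_cases h3 : x = r <;>
        simp [h1, h2, h3, hRmem, hx]
    · rw [hW]; simp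

/-- Again centred at `p`. The vertices `y` and `z` guarantee enough leaves at `p` and at `r`; `q`
takes `w₂` and, as its second leaf, `v`. -/
lemma hasHIST_of_dominating {w₁ w₂ w₃ : V} (hW : nonNbrs G v = {w₁, w₂, w₃}) (h12 : w₁ ≠ w₂)
    (h13 : w₁ ≠ w₃) (h23 : w₂ ≠ w₃) {p q r y z : V} (hp : G.Adj v p)
    (hq : G.Adj v q) (hr : G.Adj v r) (hpq : p ≠ q) (hqr : q ≠ r) (hpr : G.Adj p r)
    (hwp : G.Adj w₁ p) (hwq : G.Adj w₂ q) (hwr : G.Adj w₃ r)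
    (hy : G.Adj v y) (hz : G.Adj v z) (hyz : y ≠ z) (hyr : y ≠ r) (hzp : z ≠ p)
    (hpy : G.Adj p y) (hrz : G.Adj r z)
    (hdom : ∀ x, G.Adj v x → x ≠ p → x ≠ r → G.Adj p x ∨ G.Adj r x) : HasHIST G := by
  have a1 : w₁ ≠ v ∧ ¬G.Adj v w₁ := by rw [← mem_nonNbrs, hW]; simp
  have a2 : w₂ ≠ v ∧ ¬G.Adj v w₂ := by rw [← mem_nonNbrs, hW]; simp
  have a3 : w₃ ≠ v ∧ ¬G.Adj v w₃ := by rw [← mem_nonNbrs, hW]; simp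
  have nw : ∀ {w x : V}, ¬G.Adj v w → G.Adj v x → w ≠ x := by rintro w x h h' rfl; exact h h'
  set R := G.neighborFinset v \ {p, r} with hR
  have hRmem : ∀ x, x ∈ R ↔ G.Adj v x ∧ x ≠ p ∧ x ≠ r := by simp [hR]
  have g0 : Grows G (insert p ({w₁, r} ∪ {x ∈ R | x ≠ z ∧ G.Adj p x})) := by
    refine .star p _ ?_ ?_
    · intro x hx
      simp only [mem_union, mem_insert, mem_singleton, mem_filter] at hx
      rcases hx with (rfl | rfl) | h
      exacts [hwp.symm, hpr, h.2.2]
    · refine le_trans ?_ (card_le_card (s := {w₁, r, y}) ?_)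
      · rw [card_eq_three.2 ⟨w₁, r, y, nw a1.2 hr, nw a1.2 hy, hyr.symm, rfl⟩]
      · simp [insert_subset_iff, hRmem, hy, hyr, hpy, hpy.ne', hyz]
  have g1 := g0.expand _ r (insert w₃ {x ∈ R | x = z ∨ ¬G.Adj p x}) (by simp)
    (by
      simp only [mem_insert, mem_filter, hRmem]
      rintro x (rfl | ⟨h1, rfl | h2⟩)
      exacts [hwr.symm, hrz, (hdom x h1.1 h1.2.1 h1.2.2).resolve_left h2])
    (by
      rw [Finset.disjoint_right]
      simp only [mem_insert, mem_filter, mem_union, mem_singleton, hRmem]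
      rintro x (rfl | ⟨⟨h1, h2, h3⟩, h5⟩)
      · simp [nw a3.2 hp, nw a3.2 hr, a3, h13.symm]
      · simp only [h2, h3, (nw a1.2 h1).symm]
        tauto)
    (by
      refine le_trans ?_ (card_le_card (s := {w₃, z}) ?_)
      · rw [card_pair (nw a3.2 hz)]
      · simp [insert_subset_iff, hRmem, hz, hzp, hrz.ne'])
  have g2 := g1.pair (u := q) (by
      simp only [mem_union, mem_insert, mem_filter, hRmem, hq, hpq.symm]
      tauto) hwq.symm hq.symm
    (by simp [nw a2.2 hp, nw a2.2 hr, a2, h12.symm, h23, hRmem])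
    (by simp [hp.ne, hr.ne, a1.1.symm, a3.1.symm, hRmem]) a2.1
  refine g2.hasHIST_of_parts (v := v) (by simp) ?_ ?_
  · intro x hx
    by_cases h1 : x = p <;> by_cases h3 : x = r <;> by_cases h4 : x = z <;>
      by_cases h5 : G.Adj p x <;> simp [h1, h3, h4, h5, hRmem, hx, hz, hzp, hrz.ne']
  · rw [hW]; simp

/-- If the complement `H` of the graph induced on the neighbours of `v` has a component that contains
`A`, then it has at least `#A - 1` edges. -/
lemma two_mul_card_le_of_reachable {A : Finset V} {a : V} (H : SimpleGraph V) (hH : ∀ x y, H.Adj x y ↔ x ≠ y ∧ G.Adj v x ∧ G.Adj v y ∧ ¬G.Adj x y)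
    (hreach : ∀ x ∈ A, H.Reachable a x) :
    2 * #A ≤ ∑ x ∈ G.neighborFinset v, coDeg G v x + 2 := by
  classical
  have hsum : ∑ x ∈ G.neighborFinset v, coDeg G v x = 2 * #H.edgeFinset := by
    rw [← sum_degrees_eq_twice_card_edges]
    have h0 : ∀ x, x ∉ G.neighborFinset v → H.degree x = 0 := by
      intro x hx
      rw [← card_neighborFinset_eq_degree, card_eq_zero, eq_empty_iff_forall_notMem]
      intro y hy
      rw [mem_neighborFinset, hH] at hy
      exact hx ((mem_neighborFinset ..).2 hy.2.1)
    rw [← sum_subset (subset_univ (G.neighborFinset v)) fun x _ hx => h0 x hx]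
    refine sum_congr rfl fun x hx => ?_
    rw [coDeg, ← card_neighborFinset_eq_degree]
    congr 1
    ext y
    rw [mem_neighborFinset] at hx
    simp only [mem_filter, mem_neighborFinset, hH, hx]
    tauto
  set C := H.connectedComponentMk a with hC
  have hconn := C.connected_toSimpleGraph
  have h1 := hconn.card_vert_le_card_edgeSet_add_one
  have h2 : #A ≤ Nat.card C := by
    have : (A : Set V) ⊆ C.supp := fun x hx => by
      rw [ConnectedComponent.mem_supp_iff, hC, ConnectedComponent.eq]
      exact (hreach x hx).symm
    have := Set.ncard_le_ncard this (Set.toFinite _)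
    rwa [Set.ncard_coe_finset] at this
  have h3 : Nat.card C.toSimpleGraph.edgeSet ≤ #H.edgeFinset := by
    have hle := Nat.card_le_card_of_injective
      (C.toSimpleGraph_hom.mapEdgeSet) (Hom.mapEdgeSet.injective _ Subtype.val_injective)
    rwa [Nat.card_eq_fintype_card (α := H.edgeSet), ← edgeFinset_card] at hle
  omega

end FarPair

/-! ### Numerical contradictions -/

section Arithmetic

/-- In this group `N` is the degree of `v`, `s` or `t` the number of vertices isolated inside its
neighbourhood, and `h` the co-degree of one further neighbour. Each `H` combines an isolation bound
with the edge count. -/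
lemma isolated_arith₁ {s N h : ℕ} (hs : 1 ≤ s) (hsN : s + 1 ≤ N) (hN : 4 ≤ N) (h2 : 2 ≤ h)
    (hsh : s ≤ h) (H : 2 * s * N + 2 * h + 4 ≤ 2 * N + 5 * s + s * s) : False := by
  obtain ⟨t, rfl⟩ := Nat.exists_eq_add_of_le hsN
  obtain ⟨r, rfl⟩ := Nat.exists_eq_add_of_le hs
  rcases r with _ | _ | r
  · omega
  · omega
  · nlinarith

lemma isolated_arith₂ {s N h : ℕ} (hsN : s + 1 ≤ N) (hN : 4 ≤ N) (h2 : 2 ≤ h) (hsh : s ≤ h)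
    (H : 2 * s * N + 2 * h ≤ 5 * s + s * s + 2) : False := by
  obtain ⟨t, rfl⟩ := Nat.exists_eq_add_of_le hsN
  rcases s with _ | _ | _ | r
  · omega
  · omega
  · omega
  · nlinarith

lemma isolated_arith₃ {s N h : ℕ} (hs : 2 ≤ s) (hsN : s + 1 ≤ N) (hsh : s ≤ h)
    (H : 2 * s * N + 2 * h + 4 ≤ 4 * N + s + s * s) : False := by
  obtain ⟨t, rfl⟩ := Nat.exists_eq_add_of_le hsN
  obtain ⟨r, rfl⟩ := Nat.exists_eq_add_of_le hs
  nlinarith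

lemma isolated_arith₄ {t N : ℕ} (ht : 3 ≤ t) (htN : t ≤ N) (hN : 4 ≤ N)
    (H : 2 * t * N + 6 ≤ 4 * N + t + t * t) : False := by
  obtain ⟨s, rfl⟩ := Nat.exists_eq_add_of_le htN
  obtain ⟨r, rfl⟩ := Nat.exists_eq_add_of_le ht
  rcases r with _ | _ | r
  · omega
  · omega
  · nlinarith

lemma isolated_arith₅ {t N : ℕ} (ht : 3 ≤ t) (htN : t ≤ N) (hN : 5 ≤ N)
    (H : 2 * t * N + 4 ≤ 4 * N + t + t * t) : False := by
  obtain ⟨s, rfl⟩ := Nat.exists_eq_add_of_le htN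
  obtain ⟨r, rfl⟩ := Nat.exists_eq_add_of_le ht
  rcases r with _ | _ | r
  · omega
  · omega
  · nlinarith

end Arithmetic

/-! ### Cases by the size of `nonNbrs G v`: common tools, then three vertices -/

section Cases

variable {V : Type*} [Fintype V] [DecidableEq V] {G : SimpleGraph V} [DecidableRel G.Adj] {v : V}

/-- Since `v` has maximum degree, each link from `u` to `nonNbrs` is paid for by a missing adjacency
inside the neighbourhood of `v`. -/
lemma cov_le_coDeg (hmax : ∀ u, G.degree u ≤ G.degree v) {u : V} (hu : G.Adj v u) :
    cov G v u ≤ coDeg G v u := by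
  have := degree_add_coDeg hu
  have := hmax u
  omega

lemma cov_lt_of_not_hasHIST (h : ¬HasHIST G) (hN : 3 ≤ G.degree v) (hW : 2 ≤ #(nonNbrs G v)) {u : V}
    (hu : G.Adj v u) : cov G v u < #(nonNbrs G v) := by
  rw [cov]
  refine lt_of_le_of_ne (card_filter_le _ _) fun e => h ?_
  exact hasHIST_of_cov_all hN hW hu (card_filter_eq_iff.1 e)

/-- Bounds the number of links; members of `A` save one each, and `A = ∅` gives the plain bound. -/
lemma sum_cov_add_card_le {A : Finset V} (hA : A ⊆ G.neighborFinset v) {c : ℕ}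
    (hc : ∀ u, G.Adj v u → cov G v u ≤ c) (hcA : ∀ u ∈ A, cov G v u + 1 ≤ c) :
    ∑ w ∈ nonNbrs G v, #(common G v w) + #A ≤ c * G.degree v := by
  rw [← sum_cov_eq, ← sum_sdiff hA, ← card_neighborFinset_eq_degree]
  have h1 : ∑ u ∈ A, cov G v u + #A ≤ c * #A := by
    have : ∑ u ∈ A, (cov G v u + 1) ≤ ∑ u ∈ A, c := sum_le_sum hcA
    simpa [sum_add_distrib, mul_comm] using this
  have h2 : ∑ u ∈ G.neighborFinset v \ A, cov G v u ≤ c * #(G.neighborFinset v \ A) := by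
    have : ∑ u ∈ G.neighborFinset v \ A, cov G v u ≤ ∑ u ∈ G.neighborFinset v \ A, c :=
      sum_le_sum fun u hu => hc u (by simpa using (mem_sdiff.1 hu).1)
    simpa [mul_comm] using this
  rw [← card_sdiff_add_card_eq_card hA, mul_add]
  omega

lemma card_common_le (w : V) : #(common G v w) ≤ G.degree v := by
  rw [← card_neighborFinset_eq_degree]
  exact card_le_card (common_subset w)

lemma card_common_lt {w u : V} (hu : G.Adj v u) (huw : ¬G.Adj w u) :
    #(common G v w) + 1 ≤ G.degree v := by
  rw [← card_neighborFinset_eq_degree]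
  refine card_lt_card ⟨common_subset w, fun h => huw ?_⟩
  exact (mem_common.1 (h ((mem_neighborFinset ..).2 hu))).2

lemma cov_triple {w₁ w₂ w₃ : V} (hW : nonNbrs G v = {w₁, w₂, w₃}) (h12 : w₁ ≠ w₂) (h13 : w₁ ≠ w₃)
    (h23 : w₂ ≠ w₃) (u : V) : cov G v u =
      (if G.Adj u w₁ then 1 else 0) + (if G.Adj u w₂ then 1 else 0) +
        (if G.Adj u w₃ then 1 else 0) := by
  rw [cov, hW, card_filter, sum_insert (by simp [h12, h13]), sum_insert (by simp [h23]),
    sum_singleton, add_assoc]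

/-- Without a HIST, the common neighbours of `v` and `w₃` are isolated inside the neighbourhood of
`v` (`hiso`), and a neighbour of `w₃` in `nonNbrs` has `u` as its only link (`hone`). Both effects
leave too few edges. -/
lemma hasHIST_of_three_of_cov_two {w₁ w₂ w₃ : V} (hW : nonNbrs G v = {w₁, w₂, w₃}) (h12 : w₁ ≠ w₂)
    (h13 : w₁ ≠ w₃) (h23 : w₂ ≠ w₃) (hN : 4 ≤ G.degree v) (hmax : ∀ u, G.degree u ≤ G.degree v)
    (hδ : ∀ u, 2 ≤ G.degree u)
    (hm : ∑ x ∈ G.neighborFinset v, coDeg G v x + 8 ≤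
      2 * ∑ w ∈ nonNbrs G v, #(common G v w) + ∑ w ∈ nonNbrs G v, cov G v w)
    {u : V} (hu : G.Adj v u) (hu₁ : G.Adj u w₁) (hu₂ : G.Adj u w₂) (hu₃ : ¬G.Adj u w₃) :
    HasHIST G := by
  by_contra hno
  have hcard : #(nonNbrs G v) = 3 := card_eq_three.2 ⟨_, _, _, h12, h13, h23, hW⟩
  have mW : ∀ x, x ∈ nonNbrs G v ↔ x = w₁ ∨ x = w₂ ∨ x = w₃ := by simp [hW]
  have hc : ∀ x, G.Adj v x → cov G v x ≤ 2 := fun x hx => by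
    have := cov_lt_of_not_hasHIST hno (by omega) (by omega) hx
    omega
  have hiso : ∀ x ∈ common G v w₃, ∀ y, G.Adj v y → ¬G.Adj x y := by
    intro x hx y hy hxy
    rw [mem_common] at hx
    refine hno (hasHIST_of_cov_erase hN (by omega) hu ((mW w₃).2 (by simp)) ?_ hx.1 hx.2.symm hy hxy)
    intro w hw hw3
    rcases (mW w).1 hw with rfl | rfl | rfl
    exacts [hu₁, hu₂, absurd rfl hw3]
  have hone : ∀ w ∈ nonNbrs G v, G.Adj u w → G.Adj w w₃ → #(common G v w) = 1 := by
    intro w hw huw hww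
    refine card_eq_one.2 ⟨u, ?_⟩
    ext x
    rw [mem_common, mem_singleton]
    refine ⟨fun hx => ?_, fun hx => hx ▸ ⟨hu, huw.symm⟩⟩
    by_contra hxu
    refine hno (hasHIST_of_cov_erase_adj hN (by omega) hu ((mW w₃).2 (by simp)) ?_ hw hww hx.1 hxu
      hx.2)
    intro w hw hw3
    rcases (mW w).1 hw with rfl | rfl | rfl
    exacts [hu₁, hu₂, absurd rfl hw3]
  have hu3 : u ∉ common G v w₃ := by simp [G.adj_comm w₃, hu₃]
  have hL := isolated_bound (common_subset w₃) hiso hu hu3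
  have hsh := card_le_coDeg (common_subset w₃) hiso hu hu3
  have hcu := cov_le_coDeg hmax hu
  rw [cov_triple hW h12 h13 h23, if_pos hu₁, if_pos hu₂, if_neg hu₃] at hcu
  have hs := card_common_lt hu (fun h => hu₃ h.symm)
  have d1 := degree_nonNbr ((mW w₁).2 (by simp))
  have d2 := degree_nonNbr ((mW w₂).2 (by simp))
  have d3 := degree_nonNbr ((mW w₃).2 (by simp))
  have m1 := hmax w₁
  have m2 := hmax w₂
  have l3 := hδ w₃
  have hm' := hm
  rw [hW, sum_insert (by simp [h12, h13]), sum_insert (by simp [h23]), sum_singleton,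
    sum_insert (by simp [h12, h13]), sum_insert (by simp [h23]), sum_singleton] at hm'
  simp only [cov_triple hW h12 h13 h23, G.irrefl, if_false, G.adj_comm w₂ w₁, G.adj_comm w₃ w₁,
    G.adj_comm w₃ w₂] at hm' d1 d2 d3
  have e12 : (if G.Adj w₁ w₂ then 1 else 0) ≤ 1 := by split_ifs <;> simp
  have o1 := hone w₁ ((mW w₁).2 (by simp)) hu₁
  have o2 := hone w₂ ((mW w₂).2 (by simp)) hu₂
  by_cases a13 : G.Adj w₁ w₃ <;> by_cases a23 : G.Adj w₂ w₃ <;>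
    simp only [a13, a23, if_true, if_false] at hm' d1 d2 d3
  · have := o1 a13
    have := o2 a23
    exact isolated_arith₂ hs hN hcu hsh (by omega)
  · have := o1 a13
    exact isolated_arith₁ (by omega) hs hN hcu hsh (by omega)
  · have := o2 a23
    exact isolated_arith₁ (by omega) hs hN hcu hsh (by omega)
  -- All neighbours of `w₃` are now neighbours of `v`, so at least two vertices are isolated.
  · have hs2 : 2 ≤ #(common G v w₃) := by omega
    by_cases hA : ∀ x ∈ common G v w₃, cov G v x + 1 ≤ 2
    · have hsum := sum_cov_add_card_le (common_subset w₃) hc hA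
      rw [hW, sum_insert (by simp [h12, h13]), sum_insert (by simp [h23]), sum_singleton] at hsum
      exact isolated_arith₃ hs2 hs hsh (by omega)
    · push Not at hA
      obtain ⟨x, hx, hxc⟩ := hA
      have hx' := mem_common.1 hx
      rw [cov_triple hW h12 h13 h23, if_pos hx'.2.symm] at hxc
      -- `x` covers `w₃` and one of `w₁`, `w₂`, so it can play the part of `u` with respect to the
      -- other one. That makes `u` isolated as well.
      have hiu : ∀ y, G.Adj v y → ¬G.Adj u y := by
        intro y hy huy
        by_cases hx1 : G.Adj x w₁
        · refine hno (hasHIST_of_cov_erase hN (by omega) hx'.1 ((mW w₂).2 (by simp)) ?_ hu hu₂ hy huy)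
          intro w hw hw3
          rcases (mW w).1 hw with rfl | rfl | rfl
          exacts [hx1, absurd rfl hw3, hx'.2.symm]
        · by_cases hx2 : G.Adj x w₂
          · refine hno (hasHIST_of_cov_erase hN (by omega) hx'.1 ((mW w₁).2 (by simp)) ?_ hu hu₁ hy
              huy)
            intro w hw hw3
            rcases (mW w).1 hw with rfl | rfl | rfl
            exacts [absurd rfl hw3, hx2, hx'.2.symm]
          · simp [hx1, hx2] at hxc
      have hI := isolated_bound' (G := G) (v := v) (S := insert u (common G v w₃))
        (insert_subset (by simpa using hu) (common_subset w₃))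
        (by
          intro y hy
          rcases mem_insert.1 hy with rfl | hy
          exacts [hiu, hiso y hy])
      have hsum := sum_cov_add_card_le (G := G) (v := v) (A := ∅) (by simp) hc (by simp)
      rw [hW, sum_insert (by simp [h12, h13]), sum_insert (by simp [h23]), sum_singleton,
        card_empty] at hsum
      rw [card_insert_of_notMem hu3] at hI
      exact isolated_arith₄ (t := #(common G v w₃) + 1) (by omega) hs hN (by omega)

lemma card_common_add_coDeg {u : V} (hu : G.Adj v u) :
    #(common G v u) + coDeg G v u + 1 = G.degree v := by
  have h : G.neighborFinset v = insert u (common G v u) ∪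
      {x ∈ G.neighborFinset v | x ≠ u ∧ ¬G.Adj u x} := by
    ext x
    by_cases hx : x = u
    · subst hx; simp [hu]
    · by_cases hx' : G.Adj u x <;> simp [hx, hx']
  rw [← card_neighborFinset_eq_degree]
  conv_rhs => rw [h]
  rw [card_union_of_disjoint, card_insert_of_notMem (by simp), coDeg]
  · omega
  · rw [Finset.disjoint_left]
    intro x hx
    simp only [mem_insert, mem_common, mem_filter, mem_neighborFinset] at hx ⊢
    tauto

lemma sum_common_le_sum_coDeg (hmax : ∀ u, G.degree u ≤ G.degree v) :
    ∑ w ∈ nonNbrs G v, #(common G v w) ≤ ∑ x ∈ G.neighborFinset v, coDeg G v x := by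
  rw [← sum_cov_eq]
  exact sum_le_sum fun u hu => cov_le_coDeg hmax ((mem_neighborFinset ..).1 hu)

/-- If the graph induced on the neighbours of `v` misses few edges, then two sets of neighbours of
`v` contain two adjacent vertices that together dominate the neighbours of `v`. -/
lemma exists_dominating_pair {A B : Finset V} (hA : A ⊆ G.neighborFinset v)
    (hB : B ⊆ G.neighborFinset v) (hAB : Disjoint A B) (hAne : A.Nonempty) (hBne : B.Nonempty)
    (h : ∑ x ∈ G.neighborFinset v, coDeg G v x + 2 < 2 * (#A + #B)) :
    ∃ p ∈ A, ∃ r ∈ B, G.Adj p r ∧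
      ∀ x, G.Adj v x → x ≠ p → x ≠ r → G.Adj p x ∨ G.Adj r x := by
  by_contra hno
  push Not at hno
  let H : SimpleGraph V :=
    { Adj := fun x y => x ≠ y ∧ G.Adj v x ∧ G.Adj v y ∧ ¬G.Adj x y
      symm := ⟨fun x y h => ⟨h.1.symm, h.2.2.1, h.2.1, fun e => h.2.2.2 e.symm⟩⟩
      loopless := ⟨fun x h => h.1 rfl⟩ }
  have hH : ∀ x y, H.Adj x y ↔ x ≠ y ∧ G.Adj v x ∧ G.Adj v y ∧ ¬G.Adj x y := fun _ _ => Iff.rfl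
  -- If no pair works, then `p` and `r` are non-adjacent in `G` or both miss some `x`; either way
  -- they are within distance two in the complement `H`. So `A ∪ B` lies in one component of `H`,
  -- which needs too many edges.
  have hreach : ∀ p ∈ A, ∀ r ∈ B, H.Reachable p r := by
    intro p hp r hr
    have hpr : p ≠ r := fun e => Finset.disjoint_left.1 hAB hp (e ▸ hr)
    have hvp := (mem_neighborFinset ..).1 (hA hp)
    have hvr := (mem_neighborFinset ..).1 (hB hr)
    by_cases hadj : G.Adj p r
    · obtain ⟨x, hx, hxp, hxr, h1, h2⟩ := hno p hp r hr hadj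
      exact ((hH p x).2 ⟨hxp.symm, hvp, hx, h1⟩).reachable.trans
        ((hH x r).2 ⟨hxr, hx, hvr, fun e => h2 e.symm⟩).reachable
    · exact ((hH p r).2 ⟨hpr, hvp, hvr, hadj⟩).reachable
  obtain ⟨a, ha⟩ := hAne
  obtain ⟨b, hb⟩ := hBne
  have := two_mul_card_le_of_reachable (G := G) (v := v) (A := A ∪ B) (a := a) H hH (by
    intro x hx
    rcases mem_union.1 hx with hx | hx
    · exact (hreach a ha b hb).trans (hreach x hx b hb).symm
    · exact hreach a ha x hx)
  rw [card_union_of_disjoint hAB] at this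
  omega

lemma disjoint_common {w₁ w₂ : V} (h₁ : w₁ ∈ nonNbrs G v) (h₂ : w₂ ∈ nonNbrs G v) (h12 : w₁ ≠ w₂)
    (hc : ∀ x, G.Adj v x → cov G v x ≤ 1) : Disjoint (common G v w₁) (common G v w₂) := by
  rw [Finset.disjoint_left]
  intro x hx hx'
  rw [mem_common] at hx hx'
  have h := hc x hx.1
  have : #({w₁, w₂} : Finset V) ≤ cov G v x := by
    refine card_le_card ?_
    simp only [insert_subset_iff, singleton_subset_iff, mem_filter]
    exact ⟨⟨h₁, hx.2.symm⟩, h₂, hx'.2.symm⟩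
  rw [card_pair h12] at this
  omega

/-- Since `w₁` hangs on `w₂`, it needs no neighbour among those of `v`; the dominating pair comes
from the other two. -/
lemma hasHIST_of_pendant_pair {w₁ w₂ w₃ : V} (hW : nonNbrs G v = {w₁, w₂, w₃})
    (h13 : w₁ ≠ w₃) (h23 : w₂ ≠ w₃) (hN : 4 ≤ G.degree v)
    (hc : ∀ x, G.Adj v x → cov G v x ≤ 1) (h12 : G.Adj w₁ w₂)
    (h2 : 2 ≤ #(common G v w₂)) (h3 : 1 ≤ #(common G v w₃))
    (hm : ∑ x ∈ G.neighborFinset v, coDeg G v x + 2 < 2 * (#(common G v w₂) + #(common G v w₃))) :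
    HasHIST G := by
  have mW : ∀ x, x ∈ nonNbrs G v ↔ x = w₁ ∨ x = w₂ ∨ x = w₃ := by simp [hW]
  have hdis := disjoint_common ((mW w₂).2 (by simp)) ((mW w₃).2 (by simp)) h23 hc
  obtain ⟨p, hp, r, hr, hpr, hdom⟩ := exists_dominating_pair (common_subset w₂) (common_subset w₃)
    hdis (card_pos.1 (by omega)) (card_pos.1 h3) hm
  obtain ⟨q, hq, hqp⟩ := exists_mem_ne (show 1 < #(common G v w₂) by omega) p
  have hqr : q ≠ r := fun e => Finset.disjoint_left.1 hdis hq (e ▸ hr)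
  rw [mem_common] at hp hq hr
  exact hasHIST_of_dominating_pendant hW h13 h23 h12 hN hp.1 hq.1 hr.1 hqp.symm hqr hpr hp.2 hq.2
    hr.2 hdom

lemma hasHIST_of_dominating_pair {w₁ w₂ w₃ : V} (hW : nonNbrs G v = {w₁, w₂, w₃}) (h12 : w₁ ≠ w₂)
    (h13 : w₁ ≠ w₃) (h23 : w₂ ≠ w₃) (hN : 6 ≤ G.degree v)
    (hc : ∀ x, G.Adj v x → cov G v x ≤ 1)
    (hm : ∑ x ∈ G.neighborFinset v, coDeg G v x + 6 ≤ 2 * G.degree v) {p q r : V}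
    (hp : p ∈ common G v w₁) (hq : q ∈ common G v w₂) (hr : r ∈ common G v w₃) (hpr : G.Adj p r)
    (hdom : ∀ x, G.Adj v x → x ≠ p → x ≠ r → G.Adj p x ∨ G.Adj r x) : HasHIST G := by
  have mW : ∀ x, x ∈ nonNbrs G v ↔ x = w₁ ∨ x = w₂ ∨ x = w₃ := by simp [hW]
  have hpq : p ≠ q := fun e => Finset.disjoint_left.1
    (disjoint_common ((mW w₁).2 (by simp)) ((mW w₂).2 (by simp)) h12 hc) hp (e ▸ hq)
  have hqr : q ≠ r := fun e => Finset.disjoint_left.1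
    (disjoint_common ((mW w₂).2 (by simp)) ((mW w₃).2 (by simp)) h23 hc) hq (e ▸ hr)
  rw [mem_common] at hp hq hr
  have cp := card_common_add_coDeg hp.1
  have cr := card_common_add_coDeg hr.1
  have bp := two_mul_coDeg_le hp.1
  have br := two_mul_coDeg_le hr.1
  have hY : #((common G v p).erase r) = #(common G v p) - 1 :=
    card_erase_of_mem (mem_common.2 ⟨hr.1, hpr⟩)
  have hZ : #((common G v r).erase p) = #(common G v r) - 1 :=
    card_erase_of_mem (mem_common.2 ⟨hp.1, hpr.symm⟩)
  -- By domination no vertex is missed by both `p` and `r`. Their neighbourhoods inside that of `v`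
  -- are therefore large enough together for distinct `y` and `z`.
  have hcap : coDeg G v p + coDeg G v r + 2 ≤ G.degree v := by
    rw [coDeg, coDeg, ← card_union_of_disjoint, ← card_neighborFinset_eq_degree,
      ← card_sdiff_add_card_eq_card (s := {p, r}) (t := G.neighborFinset v), card_pair hpr.ne]
    · refine Nat.add_le_add_right (card_le_card fun x hx => ?_) 2
      simp only [mem_union, mem_filter, mem_sdiff, mem_insert, mem_singleton] at hx ⊢
      rcases hx with hx | hx
      · exact ⟨hx.1, by rintro (h | rfl); exacts [hx.2.1 h, hx.2.2 hpr]⟩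
      · exact ⟨hx.1, by rintro (rfl | h); exacts [hx.2.2 hpr.symm, hx.2.1 h]⟩
    · simp [insert_subset_iff, hp.1, hr.1]
    · rw [Finset.disjoint_left]
      intro x hx hx'
      simp only [mem_filter, mem_neighborFinset] at hx hx'
      have := hdom x hx.1 hx.2.1 hx'.2.1
      tauto
  have hyz : ∃ y ∈ (common G v p).erase r, ∃ z ∈ (common G v r).erase p, y ≠ z := by
    obtain ⟨z, hz⟩ := card_pos.1 (show 0 < #((common G v r).erase p) by omega)
    obtain ⟨y, hy⟩ := card_pos.1 (show 0 < #((common G v p).erase r) by omega)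
    by_cases h2 : 2 ≤ #((common G v p).erase r)
    · obtain ⟨y', hy', hne⟩ := exists_mem_ne (show 1 < #((common G v p).erase r) by omega) z
      exact ⟨y', hy', z, hz, hne⟩
    · obtain ⟨z', hz', hne⟩ := exists_mem_ne (show 1 < #((common G v r).erase p) by omega) y
      exact ⟨y, hy, z', hz', hne.symm⟩
  obtain ⟨y, hy, z, hz, hne⟩ := hyz
  rw [mem_erase, mem_common] at hy hz
  exact hasHIST_of_dominating hW h12 h13 h23 hp.1 hq.1 hr.1 hpq hqr hpr hp.2 hq.2 hr.2 hy.2.1 hz.2.1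
    hne hy.1 hz.1 hy.2.2 hz.2.2 hdom

/-- By `hasHIST_of_center` the links of `w₁` end in isolated vertices. If the three vertices form a
triangle, this holds for all links, contradicting `hm`. Otherwise even one link of `w₁` is too
expensive, and without links `w₁` can hang on `w₂` or `w₃`. -/
lemma hasHIST_of_three_of_center {w₁ w₂ w₃ : V} (hW : nonNbrs G v = {w₁, w₂, w₃})
    (h23 : w₂ ≠ w₃) (hN : 4 ≤ G.degree v) (hmax : ∀ u, G.degree u ≤ G.degree v)
    (hδ : ∀ u, 2 ≤ G.degree u)
    (hm : ∑ x ∈ G.neighborFinset v, coDeg G v x + 8 ≤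
      2 * ∑ w ∈ nonNbrs G v, #(common G v w) + ∑ w ∈ nonNbrs G v, cov G v w)
    (hc : ∀ x, G.Adj v x → cov G v x ≤ 1) (a12 : G.Adj w₁ w₂) (a13 : G.Adj w₁ w₃) :
    HasHIST G := by
  by_contra hno
  have h12 := a12.ne
  have h13 := a13.ne
  have mW : ∀ x, x ∈ nonNbrs G v ↔ x = w₁ ∨ x = w₂ ∨ x = w₃ := by simp [hW]
  have hsum := sum_cov_add_card_le (G := G) (v := v) (A := ∅) (by simp) hc (by simp)
  have hle := sum_common_le_sum_coDeg hmax
  have d2 := degree_nonNbr ((mW w₂).2 (by simp))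
  have d3 := degree_nonNbr ((mW w₃).2 (by simp))
  have l2 := hδ w₂
  have l3 := hδ w₃
  have D12 := disjoint_common ((mW w₁).2 (by simp)) ((mW w₂).2 (by simp)) h12 hc
  have D13 := disjoint_common ((mW w₁).2 (by simp)) ((mW w₃).2 (by simp)) h13 hc
  have D23 := disjoint_common ((mW w₂).2 (by simp)) ((mW w₃).2 (by simp)) h23 hc
  rw [hW, sum_insert (by simp [h12, h13]), sum_insert (by simp [h23]), sum_singleton] at hsum hle
  rw [hW, sum_insert (by simp [h12, h13]), sum_insert (by simp [h23]), sum_singleton,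
    sum_insert (by simp [h12, h13]), sum_insert (by simp [h23]), sum_singleton] at hm
  simp only [cov_triple hW h12 h13 h23, G.irrefl, if_false, G.adj_comm w₂ w₁, G.adj_comm w₃ w₁,
    G.adj_comm w₃ w₂, a12, a13, if_true] at hm d2 d3
  have i1 : ∀ x ∈ common G v w₁, ∀ y, G.Adj v y → ¬G.Adj x y := by
    intro x hx y hy hxy
    rw [mem_common] at hx
    exact hno (hasHIST_of_center hW h23 a12 a13 hN hx.1 hx.2 hy hxy)
  rw [card_empty] at hsum
  by_cases a23 : G.Adj w₂ w₃
  · simp only [a23, if_true] at hm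
    have i2 : ∀ x ∈ common G v w₂, ∀ y, G.Adj v y → ¬G.Adj x y := by
      intro x hx y hy hxy
      rw [mem_common] at hx
      refine hno (hasHIST_of_center (w₁ := w₂) (w₂ := w₁) (w₃ := w₃) ?_ h13 a12.symm a23 hN hx.1 hx.2
        hy hxy)
      rw [hW, insert_comm]
    have i3 : ∀ x ∈ common G v w₃, ∀ y, G.Adj v y → ¬G.Adj x y := by
      intro x hx y hy hxy
      rw [mem_common] at hx
      refine hno (hasHIST_of_center (w₁ := w₃) (w₂ := w₁) (w₃ := w₂) ?_ h12 a13.symm a23.symm hN hx.1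
        hx.2 hy hxy)
      rw [hW, pair_comm w₂ w₃, insert_comm]
    have hI := isolated_bound' (G := G) (v := v)
      (S := common G v w₁ ∪ common G v w₂ ∪ common G v w₃)
      (union_subset (union_subset (common_subset _) (common_subset _)) (common_subset _))
      (by
        intro x hx
        rcases mem_union.1 hx with hx | hx
        · rcases mem_union.1 hx with hx | hx
          exacts [i1 x hx, i2 x hx]
        · exact i3 x hx)
    rw [card_union_of_disjoint (disjoint_union_left.2 ⟨D13, D23⟩), card_union_of_disjoint D12] at hI
    set s := #(common G v w₁) + #(common G v w₂) + #(common G v w₃) with hs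
    have : 2 * s * G.degree v + 2 ≤ s * s + 3 * s := by omega
    have : s ≤ G.degree v := by omega
    nlinarith
  · simp only [a23, if_false] at hm d2 d3
    rcases Nat.eq_zero_or_pos #(common G v w₁) with h0 | hpos
    · rcases Nat.lt_or_ge #(common G v w₂) 2 with h2 | h2
      · refine hno (hasHIST_of_pendant_pair (w₁ := w₁) (w₂ := w₃) (w₃ := w₂) ?_ h12 h23.symm hN hc a13
          (by omega) (by omega) (by omega))
        rw [hW, pair_comm w₂ w₃]
      · exact hno (hasHIST_of_pendant_pair hW h13 h23 hN hc a12 h2 (by omega) (by omega))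
    · have hI := isolated_bound' (common_subset w₁) i1
      have hs := card_common_le (G := G) (v := v) w₁
      set s := #(common G v w₁)
      have : 2 * s * G.degree v + 4 ≤ 2 * G.degree v + s * s + s := by omega
      nlinarith

/-- With at most one edge among the three vertices, minimum degree 2 gives each of them a link. The
edge count then makes a dominating pair available, with ends linked to `w₁` and to one of the other
two. -/
lemma hasHIST_of_three_sparse {w₁ w₂ w₃ : V} (hW : nonNbrs G v = {w₁, w₂, w₃}) (h12 : w₁ ≠ w₂)
    (h13 : w₁ ≠ w₃) (h23 : w₂ ≠ w₃) (hmax : ∀ u, G.degree u ≤ G.degree v)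
    (hδ : ∀ u, 2 ≤ G.degree u)
    (hm : ∑ x ∈ G.neighborFinset v, coDeg G v x + 8 ≤
      2 * ∑ w ∈ nonNbrs G v, #(common G v w) + ∑ w ∈ nonNbrs G v, cov G v w)
    (hc : ∀ x, G.Adj v x → cov G v x ≤ 1) (n1 : ¬(G.Adj w₁ w₂ ∧ G.Adj w₁ w₃))
    (n2 : ¬(G.Adj w₁ w₂ ∧ G.Adj w₂ w₃)) (n3 : ¬(G.Adj w₁ w₃ ∧ G.Adj w₂ w₃)) :
    HasHIST G := by
  have mW : ∀ x, x ∈ nonNbrs G v ↔ x = w₁ ∨ x = w₂ ∨ x = w₃ := by simp [hW]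
  have hsum := sum_cov_add_card_le (G := G) (v := v) (A := ∅) (by simp) hc (by simp)
  have hle := sum_common_le_sum_coDeg hmax
  have d1 := degree_nonNbr ((mW w₁).2 (by simp))
  have d2 := degree_nonNbr ((mW w₂).2 (by simp))
  have d3 := degree_nonNbr ((mW w₃).2 (by simp))
  have l1 := hδ w₁
  have l2 := hδ w₂
  have l3 := hδ w₃
  have D12 := disjoint_common ((mW w₁).2 (by simp)) ((mW w₂).2 (by simp)) h12 hc
  have D13 := disjoint_common ((mW w₁).2 (by simp)) ((mW w₃).2 (by simp)) h13 hc
  have D23 := disjoint_common ((mW w₂).2 (by simp)) ((mW w₃).2 (by simp)) h23 hc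
  rw [hW, sum_insert (by simp [h12, h13]), sum_insert (by simp [h23]), sum_singleton] at hsum hle
  rw [hW, sum_insert (by simp [h12, h13]), sum_insert (by simp [h23]), sum_singleton,
    sum_insert (by simp [h12, h13]), sum_insert (by simp [h23]), sum_singleton] at hm
  simp only [cov_triple hW h12 h13 h23, G.irrefl, if_false, G.adj_comm w₂ w₁, G.adj_comm w₃ w₁,
    G.adj_comm w₃ w₂] at hm d1 d2 d3
  rw [card_empty] at hsum
  have key : 1 ≤ #(common G v w₁) ∧ 1 ≤ #(common G v w₂) ∧ 1 ≤ #(common G v w₃) ∧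
      ∑ x ∈ G.neighborFinset v, coDeg G v x + 6 ≤
        2 * (#(common G v w₁) + (#(common G v w₂) + #(common G v w₃))) := by
    by_cases a12 : G.Adj w₁ w₂ <;> by_cases a13 : G.Adj w₁ w₃ <;> by_cases a23 : G.Adj w₂ w₃ <;>
      simp only [a12, a13, a23, if_true, if_false, and_self, and_true, and_false, not_true,
        not_false_iff] at hm d1 d2 d3 n1 n2 n3 <;> omega
  obtain ⟨k1, k2, k3, hk⟩ := key
  obtain ⟨p, hp, r, hr, hpr, hdom⟩ := exists_dominating_pair (G := G) (v := v)
    (A := common G v w₁) (B := common G v w₂ ∪ common G v w₃) (common_subset _)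
    (union_subset (common_subset _) (common_subset _)) (disjoint_union_right.2 ⟨D12, D13⟩)
    (card_pos.1 k1) ((card_pos.1 k2).mono subset_union_left)
    (by rw [card_union_of_disjoint D23]; omega)
  rcases mem_union.1 hr with hr | hr
  · obtain ⟨q, hq⟩ := card_pos.1 k3
    refine hasHIST_of_dominating_pair (w₁ := w₁) (w₂ := w₃) (w₃ := w₂) ?_ h13 h12 h23.symm
      (by omega) hc (by omega) hp hq hr hpr hdom
    rw [hW, pair_comm w₂ w₃]
  · obtain ⟨q, hq⟩ := card_pos.1 k2
    exact hasHIST_of_dominating_pair hW h12 h13 h23 (by omega) hc (by omega) hp hq hr hpr hdom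

lemma hasHIST_of_card_nonNbrs_eq_three (hk : #(nonNbrs G v) = 3) (hN : 4 ≤ G.degree v)
    (hmax : ∀ u, G.degree u ≤ G.degree v) (hδ : ∀ u, 2 ≤ G.degree u)
    (hm : ∑ x ∈ G.neighborFinset v, coDeg G v x + 8 ≤
      2 * ∑ w ∈ nonNbrs G v, #(common G v w) + ∑ w ∈ nonNbrs G v, cov G v w) :
    HasHIST G := by
  obtain ⟨w₁, w₂, w₃, h12, h13, h23, hW⟩ := card_eq_three.1 hk
  have hW' : nonNbrs G v = {w₁, w₃, w₂} := by rw [hW, pair_comm w₂ w₃]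
  have hW'' : nonNbrs G v = {w₂, w₃, w₁} := by rw [hW, insert_comm, pair_comm w₁ w₃]
  by_contra hno
  have hc : ∀ x, G.Adj v x → cov G v x ≤ 1 := by
    intro x hx
    have hlt := cov_lt_of_not_hasHIST hno (by omega) (by omega) hx
    rw [cov_triple hW h12 h13 h23] at hlt ⊢
    by_cases a1 : G.Adj x w₁ <;> by_cases a2 : G.Adj x w₂ <;> by_cases a3 : G.Adj x w₃ <;>
      simp only [a1, a2, a3, if_true, if_false] at hlt ⊢
    · omega
    · exact (hno (hasHIST_of_three_of_cov_two hW h12 h13 h23 hN hmax hδ hm hx a1 a2 a3)).elim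
    · exact (hno (hasHIST_of_three_of_cov_two hW' h13 h12 h23.symm hN hmax hδ hm hx a1 a3 a2)).elim
    · omega
    · exact (hno (hasHIST_of_three_of_cov_two hW'' h23 h12.symm h13.symm hN hmax hδ hm hx a2 a3
        a1)).elim
    all_goals omega
  refine hno (hasHIST_of_three_sparse hW h12 h13 h23 hmax hδ hm hc ?_ ?_ ?_)
  · rintro ⟨a, b⟩
    exact hno (hasHIST_of_three_of_center hW h23 hN hmax hδ hm hc a b)
  · rintro ⟨a, b⟩
    refine hno (hasHIST_of_three_of_center (w₁ := w₂) (w₂ := w₁) (w₃ := w₃) ?_ h13 hN hmax hδ hm hc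
      a.symm b)
    rw [hW, insert_comm]
  · rintro ⟨a, b⟩
    refine hno (hasHIST_of_three_of_center (w₁ := w₃) (w₂ := w₁) (w₃ := w₂) ?_ h12 hN hmax hδ hm hc
      a.symm b.symm)
    rw [hW, pair_comm w₂ w₃, insert_comm]

/-! ### Four and five vertices outside the closed neighbourhood -/

lemma sum_quad {w₁ w₂ w₃ w₄ : V} (h12 : w₁ ≠ w₂) (h13 : w₁ ≠ w₃) (h14 : w₁ ≠ w₄) (h23 : w₂ ≠ w₃)
    (h24 : w₂ ≠ w₄) (h34 : w₃ ≠ w₄) (f : V → ℕ) :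
    ∑ w ∈ ({w₁, w₂, w₃, w₄} : Finset V), f w = f w₁ + f w₂ + f w₃ + f w₄ := by
  rw [sum_insert (by simp [h12, h13, h14]), sum_insert (by simp [h23, h24]),
    sum_insert (by simp [h34]), sum_singleton]
  ring

lemma cov_quad {w₁ w₂ w₃ w₄ : V} (hW : nonNbrs G v = {w₁, w₂, w₃, w₄}) (h12 : w₁ ≠ w₂)
    (h13 : w₁ ≠ w₃) (h14 : w₁ ≠ w₄) (h23 : w₂ ≠ w₃) (h24 : w₂ ≠ w₄) (h34 : w₃ ≠ w₄) (u : V) :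
    cov G v u = (if G.Adj u w₁ then 1 else 0) + (if G.Adj u w₂ then 1 else 0) +
        (if G.Adj u w₃ then 1 else 0) + (if G.Adj u w₄ then 1 else 0) := by
  rw [cov, hW, card_filter, sum_quad h12 h13 h14 h23 h24 h34]

/-- A vertex adjacent to all but one vertex at distance two from `v` restricts the neighbourhoods. -/
lemma structure_of_cov_erase (hno : ¬HasHIST G) (hN : 4 ≤ G.degree v) (hk : 3 ≤ #(nonNbrs G v))
    {u w : V} (hu : G.Adj v u) (hw : w ∈ nonNbrs G v)
    (hcov : ∀ w' ∈ nonNbrs G v, w' ≠ w → G.Adj u w') :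
    (∀ x ∈ common G v w, ∀ y, G.Adj v y → ¬G.Adj x y) ∧
      ∀ w' ∈ nonNbrs G v, G.Adj w' w → #(common G v w') = 1 := by
  constructor
  · intro x hx y hy hxy
    rw [mem_common] at hx
    exact hno (hasHIST_of_cov_erase hN hk hu hw hcov hx.1 hx.2.symm hy hxy)
  · intro w' hw' hww
    refine card_eq_one.2 ⟨u, ?_⟩
    ext x
    rw [mem_common, mem_singleton]
    refine ⟨fun hx => ?_, fun hx => hx ▸ ⟨hu, (hcov w' hw' hww.ne).symm⟩⟩
    by_contra hxu
    exact hno (hasHIST_of_cov_erase_adj hN hk hu hw hcov hw' hww hx.1 hxu hx.2)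

/-- The scheme of `hasHIST_of_three_of_cov_two`, with one more restriction (`hnadj`): a neighbour of
`w₄` in `nonNbrs` has no other neighbour there. -/
lemma hasHIST_of_four_of_cov_three {w₁ w₂ w₃ w₄ : V} (hW : nonNbrs G v = {w₁, w₂, w₃, w₄})
    (h12 : w₁ ≠ w₂) (h13 : w₁ ≠ w₃) (h14 : w₁ ≠ w₄) (h23 : w₂ ≠ w₃) (h24 : w₂ ≠ w₄) (h34 : w₃ ≠ w₄)
    (hN : 5 ≤ G.degree v) (hmax : ∀ u, G.degree u ≤ G.degree v) (hδ : ∀ u, 2 ≤ G.degree u)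
    (hm : ∑ x ∈ G.neighborFinset v, coDeg G v x + 2 * G.degree v + 10 ≤
      2 * ∑ w ∈ nonNbrs G v, #(common G v w) + ∑ w ∈ nonNbrs G v, cov G v w)
    {u : V} (hu : G.Adj v u) (hu₁ : G.Adj u w₁) (hu₂ : G.Adj u w₂) (hu₃ : G.Adj u w₃)
    (hu₄ : ¬G.Adj u w₄) : HasHIST G := by
  by_contra hno
  have mW : ∀ x, x ∈ nonNbrs G v ↔ x = w₁ ∨ x = w₂ ∨ x = w₃ ∨ x = w₄ := by simp [hW]
  have hcard : #(nonNbrs G v) = 4 := by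
    rw [hW, card_eq_sum_ones, sum_quad h12 h13 h14 h23 h24 h34]
  have cq := cov_quad hW h12 h13 h14 h23 h24 h34
  have hc : ∀ x, G.Adj v x → cov G v x ≤ 3 := fun x hx => by
    have := cov_lt_of_not_hasHIST hno (by omega) (by omega) hx
    omega
  have hcov : ∀ w ∈ nonNbrs G v, w ≠ w₄ → G.Adj u w := by
    intro w hw hw4
    rcases (mW w).1 hw with rfl | rfl | rfl | rfl
    exacts [hu₁, hu₂, hu₃, absurd rfl hw4]
  have q1 := (mW w₁).2 (by simp)
  have q2 := (mW w₂).2 (by simp)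
  have q3 := (mW w₃).2 (by simp)
  have q4 := (mW w₄).2 (by simp)
  obtain ⟨hiso, hone⟩ := structure_of_cov_erase hno (by omega) (by omega) hu q4 hcov
  have hnadj : ∀ w ∈ nonNbrs G v, G.Adj w w₄ → ∀ x ∈ nonNbrs G v, x ≠ w₄ → ¬G.Adj w x :=
    fun w hw hww x hx hxw hwx => hno (hasHIST_of_cov_erase_adj_adj (by omega) (by omega) hu q4 hcov
      hw hww hx hxw hwx)
  have hu4 : u ∉ common G v w₄ := by simp [G.adj_comm w₄, hu₄]
  have hL := isolated_bound (common_subset w₄) hiso hu hu4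
  have hsh := card_le_coDeg (common_subset w₄) hiso hu hu4
  have hcu := cov_le_coDeg hmax hu
  rw [cq, if_pos hu₁, if_pos hu₂, if_pos hu₃, if_neg hu₄] at hcu
  have hs := card_common_lt hu (fun h => hu₄ h.symm)
  have d4 := degree_nonNbr q4
  have l4 := hδ w₄
  have hm' := hm
  rw [hW, sum_quad h12 h13 h14 h23 h24 h34, sum_quad h12 h13 h14 h23 h24 h34] at hm'
  simp only [cq, G.irrefl, if_false, G.adj_comm w₂ w₁, G.adj_comm w₃ w₁,
    G.adj_comm w₃ w₂, G.adj_comm w₄ w₁, G.adj_comm w₄ w₂, G.adj_comm w₄ w₃] at hm' d4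
  have e12 : (if G.Adj w₁ w₂ then 1 else 0) ≤ 1 := by split_ifs <;> simp
  have e13 : (if G.Adj w₁ w₃ then 1 else 0) ≤ 1 := by split_ifs <;> simp
  have e23 : (if G.Adj w₂ w₃ then 1 else 0) ≤ 1 := by split_ifs <;> simp
  have b1 := card_common_le (G := G) (v := v) w₁
  have b2 := card_common_le (G := G) (v := v) w₂
  have b3 := card_common_le (G := G) (v := v) w₃
  have f1 : G.Adj w₁ w₄ → #(common G v w₁) = 1 ∧ (if G.Adj w₁ w₂ then 1 else 0) = 0 ∧
      (if G.Adj w₁ w₃ then 1 else 0) = 0 := fun h =>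
    ⟨hone w₁ q1 h, if_neg (hnadj w₁ q1 h w₂ q2 h24), if_neg (hnadj w₁ q1 h w₃ q3 h34)⟩
  have f2 : G.Adj w₂ w₄ → #(common G v w₂) = 1 ∧ (if G.Adj w₁ w₂ then 1 else 0) = 0 ∧
      (if G.Adj w₂ w₃ then 1 else 0) = 0 := fun h =>
    ⟨hone w₂ q2 h, if_neg fun e => hnadj w₂ q2 h w₁ q1 h14 e.symm,
      if_neg (hnadj w₂ q2 h w₃ q3 h34)⟩
  have f3 : G.Adj w₃ w₄ → #(common G v w₃) = 1 ∧ (if G.Adj w₁ w₃ then 1 else 0) = 0 ∧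
      (if G.Adj w₂ w₃ then 1 else 0) = 0 := fun h =>
    ⟨hone w₃ q3 h, if_neg fun e => hnadj w₃ q3 h w₁ q1 h14 e.symm,
      if_neg fun e => hnadj w₃ q3 h w₂ q2 h24 e.symm⟩
  generalize (if G.Adj w₁ w₂ then 1 else 0) = e₁₂ at *
  generalize (if G.Adj w₁ w₃ then 1 else 0) = e₁₃ at *
  generalize (if G.Adj w₂ w₃ then 1 else 0) = e₂₃ at *
  by_cases a14 : G.Adj w₁ w₄ <;> by_cases a24 : G.Adj w₂ w₄ <;> by_cases a34 : G.Adj w₃ w₄ <;>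
    simp only [a14, a24, a34, if_true, if_false, forall_const, false_imp_iff] at hm' d4 f1 f2 f3
  · exact isolated_arith₂ hs (by omega) (by omega) hsh (by omega)
  · exact isolated_arith₂ hs (by omega) (by omega) hsh (by omega)
  · exact isolated_arith₂ hs (by omega) (by omega) hsh (by omega)
  · exact isolated_arith₁ (by omega) hs (by omega) (by omega) hsh (by omega)
  · exact isolated_arith₂ hs (by omega) (by omega) hsh (by omega)
  · exact isolated_arith₁ (by omega) hs (by omega) (by omega) hsh (by omega)
  · exact isolated_arith₁ (by omega) hs (by omega) (by omega) hsh (by omega)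
  · have hs2 : 2 ≤ #(common G v w₄) := by omega
    by_cases hA : ∀ x ∈ common G v w₄, cov G v x + 1 ≤ 3
    · have hsum := sum_cov_add_card_le (common_subset w₄) hc hA
      rw [hW, sum_quad h12 h13 h14 h23 h24 h34] at hsum
      exact isolated_arith₃ hs2 hs hsh (by omega)
    · push Not at hA
      obtain ⟨x, hx, hxc⟩ := hA
      have hx' := mem_common.1 hx
      rw [cq, if_pos hx'.2.symm] at hxc
      have hiu : ∀ y, G.Adj v y → ¬G.Adj u y := by
        have step : ∀ w ∈ nonNbrs G v, G.Adj u w → (∀ w' ∈ nonNbrs G v, w' ≠ w → G.Adj x w') →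
            ∀ y, G.Adj v y → ¬G.Adj u y := fun w hw huw hxw =>
          (structure_of_cov_erase hno (by omega) (by omega) hx'.1 hw hxw).1 u
            (mem_common.2 ⟨hu, huw.symm⟩)
        by_cases x1 : G.Adj x w₁
        · by_cases x2 : G.Adj x w₂
          · refine step w₃ q3 hu₃ fun w hw hne => ?_
            rcases (mW w).1 hw with rfl | rfl | rfl | rfl
            exacts [x1, x2, absurd rfl hne, hx'.2.symm]
          · by_cases x3 : G.Adj x w₃
            · refine step w₂ q2 hu₂ fun w hw hne => ?_
              rcases (mW w).1 hw with rfl | rfl | rfl | rfl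
              exacts [x1, absurd rfl hne, x3, hx'.2.symm]
            · simp [x1, x2, x3] at hxc
        · by_cases x2 : G.Adj x w₂
          · by_cases x3 : G.Adj x w₃
            · refine step w₁ q1 hu₁ fun w hw hne => ?_
              rcases (mW w).1 hw with rfl | rfl | rfl | rfl
              exacts [absurd rfl hne, x2, x3, hx'.2.symm]
            · simp [x1, x2, x3] at hxc
          · by_cases x3 : G.Adj x w₃ <;> simp [x1, x2, x3] at hxc
      have hI := isolated_bound' (G := G) (v := v) (S := insert u (common G v w₄))
        (insert_subset (by simpa using hu) (common_subset w₄))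
        (by
          intro y hy
          rcases mem_insert.1 hy with rfl | hy
          exacts [hiu, hiso y hy])
      have hsum := sum_cov_add_card_le (G := G) (v := v) (A := ∅) (by simp) hc (by simp)
      rw [hW, sum_quad h12 h13 h14 h23 h24 h34, card_empty] at hsum
      rw [card_insert_of_notMem hu4] at hI
      exact isolated_arith₅ (t := #(common G v w₄) + 1) (by omega) hs hN (by omega)

lemma hasHIST_of_card_nonNbrs_eq_four (hk : #(nonNbrs G v) = 4) (hN : 5 ≤ G.degree v)
    (hmax : ∀ u, G.degree u ≤ G.degree v) (hδ : ∀ u, 2 ≤ G.degree u)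
    (hm : ∑ x ∈ G.neighborFinset v, coDeg G v x + 2 * G.degree v + 10 ≤
      2 * ∑ w ∈ nonNbrs G v, #(common G v w) + ∑ w ∈ nonNbrs G v, cov G v w) :
    HasHIST G := by
  by_contra hno
  have hc : ∀ x, G.Adj v x → cov G v x ≤ 2 := by
    intro x hx
    have hlt := cov_lt_of_not_hasHIST hno (by omega) (by omega) hx
    by_contra h3
    have hsplit := card_filter_add_card_filter_not (s := nonNbrs G v) (fun w => G.Adj x w)
    have h3' : #{w ∈ nonNbrs G v | G.Adj x w} = 3 := by rw [cov] at hlt h3; omega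
    have h1' : #{w ∈ nonNbrs G v | ¬G.Adj x w} = 1 := by omega
    obtain ⟨w₁, w₂, w₃, h12, h13, h23, hA⟩ := card_eq_three.1 h3'
    obtain ⟨w₄, hB⟩ := card_eq_one.1 h1'
    have hW : nonNbrs G v = {w₁, w₂, w₃, w₄} := by
      rw [← filter_union_filter_not_eq (fun w => G.Adj x w) (nonNbrs G v), hA, hB]
      ext; simp
    have m1 : w₁ ∈ nonNbrs G v ∧ G.Adj x w₁ := mem_filter.1 (hA ▸ by simp)
    have m2 : w₂ ∈ nonNbrs G v ∧ G.Adj x w₂ := mem_filter.1 (hA ▸ by simp)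
    have m3 : w₃ ∈ nonNbrs G v ∧ G.Adj x w₃ := mem_filter.1 (hA ▸ by simp)
    have m4 : w₄ ∈ nonNbrs G v ∧ ¬G.Adj x w₄ := by
      simpa [hB] using (mem_filter (s := nonNbrs G v) (p := fun w => ¬G.Adj x w) (a := w₄)).symm
    have ne : ∀ w, G.Adj x w → w ≠ w₄ := by rintro w hw rfl; exact m4.2 hw
    exact hno (hasHIST_of_four_of_cov_three hW h12 h13 (ne _ m1.2) h23 (ne _ m2.2) (ne _ m3.2) hN
      hmax hδ hm hx m1.2 m2.2 m3.2 m4.2)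
  have hsum := sum_cov_add_card_le (G := G) (v := v) (A := ∅) (by simp) hc (by simp)
  have hle := sum_common_le_sum_coDeg hmax
  rw [card_empty] at hsum
  -- With `cov` at most 1 there are at most N links (N the degree of `v`), whereas `hm` and `hle`
  -- demand at least 2N - 2.
  obtain ⟨u, hu, hu2⟩ : ∃ u, G.Adj v u ∧ 1 < cov G v u := by
    by_contra! hall
    have h1 := sum_cov_add_card_le (G := G) (v := v) (A := ∅) (by simp) hall (by simp)
    have h3 : ∑ w ∈ nonNbrs G v, cov G v w ≤ 4 * 3 := by
      rw [← hk, ← smul_eq_mul]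
      refine sum_le_card_nsmul _ _ _ fun w hw => ?_
      have : {x ∈ nonNbrs G v | G.Adj w x} ⊆ (nonNbrs G v).erase w := fun x hx => by
        rw [mem_filter] at hx
        exact mem_erase.2 ⟨hx.2.ne', hx.1⟩
      have := card_le_card this
      rw [card_erase_of_mem hw, hk] at this
      exact this
    rw [card_empty] at h1
    omega
  obtain ⟨w₁, h₁, w₂, h₂, h12⟩ := one_lt_card.1 hu2
  rw [mem_filter] at h₁ h₂
  have hR : #(((nonNbrs G v).erase w₁).erase w₂) = 2 := by
    rw [card_erase_of_mem (mem_erase.2 ⟨h12.symm, h₂.1⟩), card_erase_of_mem h₁.1, hk]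
  obtain ⟨w₃, w₄, h34, hR⟩ := card_eq_two.1 hR
  have m3 : w₃ ∈ ((nonNbrs G v).erase w₁).erase w₂ := by rw [hR]; simp
  have m4 : w₄ ∈ ((nonNbrs G v).erase w₁).erase w₂ := by rw [hR]; simp
  simp only [mem_erase] at m3 m4
  have hW : nonNbrs G v = {w₁, w₂, w₃, w₄} := by
    rw [← hR, insert_erase (mem_erase.2 ⟨h12.symm, h₂.1⟩), insert_erase h₁.1]
  have h13 := m3.2.1.symm
  have h14 := m4.2.1.symm
  have h23 := m3.1.symm
  have h24 := m4.1.symm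
  rw [hW, sum_quad h12 h13 h14 h23 h24 h34] at hsum hle
  rw [hW, sum_quad h12 h13 h14 h23 h24 h34, sum_quad h12 h13 h14 h23 h24 h34] at hm
  simp only [cov_quad hW h12 h13 h14 h23 h24 h34, G.irrefl, if_false, G.adj_comm w₂ w₁,
    G.adj_comm w₃ w₁, G.adj_comm w₃ w₂, G.adj_comm w₄ w₁, G.adj_comm w₄ w₂, G.adj_comm w₄ w₃] at hm
  have e12 : (if G.Adj w₁ w₂ then 1 else 0) ≤ 1 := by split_ifs <;> simp
  have e34 : (if G.Adj w₃ w₄ then 1 else 0) ≤ 1 := by split_ifs <;> simp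
  -- At most 2N links, set against `hm` and `hle`, force at least five of the six possible edges
  -- among the four vertices.
  have key : (G.Adj w₁ w₃ ∧ G.Adj w₁ w₄) ∨ (G.Adj w₂ w₃ ∧ G.Adj w₂ w₄) := by
    generalize (if G.Adj w₁ w₂ then 1 else 0) = e₁₂ at *
    generalize (if G.Adj w₃ w₄ then 1 else 0) = e₃₄ at *
    by_cases a13 : G.Adj w₁ w₃ <;> by_cases a14 : G.Adj w₁ w₄ <;> by_cases a23 : G.Adj w₂ w₃ <;>
      by_cases a24 : G.Adj w₂ w₄ <;>
      simp only [a13, a14, a23, a24, if_true, if_false, and_true, and_false, or_true, or_false] at hm ⊢ <;> omega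
  rcases key with ⟨a, b⟩ | ⟨a, b⟩
  · exact hno (hasHIST_of_four hW h12 h23 h24 h34 a b (by omega) hu h₁.2 h₂.2)
  · exact hno (hasHIST_of_four (by rw [hW, insert_comm]) h12.symm h13 h14 h34 a b (by omega) hu h₂.2
      h₁.2)

/-- With N the degree of `v`, the count demands at least 4N - 6 links, more than 3N, so some `u`
covers all but one vertex `w`. If `w` has a neighbour in `nonNbrs`, that neighbour has a single
link, so `w` has at least N - 7 links, all ending in isolated vertices. Otherwise `nonNbrs` spans at
most six edges. Both contradict `hm`. -/
lemma hasHIST_of_card_nonNbrs_eq_five (hk : #(nonNbrs G v) = 5) (hN : 14 ≤ G.degree v)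
    (hmax : ∀ u, G.degree u ≤ G.degree v)
    (hm : ∑ x ∈ G.neighborFinset v, coDeg G v x + 4 * G.degree v + 14 ≤
      2 * ∑ w ∈ nonNbrs G v, #(common G v w) + ∑ w ∈ nonNbrs G v, cov G v w) :
    HasHIST G := by
  by_contra hno
  have hle := sum_common_le_sum_coDeg hmax
  have hcw : ∀ w ∈ nonNbrs G v, cov G v w ≤ 4 := by
    intro w hw
    have : {x ∈ nonNbrs G v | G.Adj w x} ⊆ (nonNbrs G v).erase w := fun x hx => by
      rw [mem_filter] at hx
      exact mem_erase.2 ⟨hx.2.ne', hx.1⟩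
    have := card_le_card this
    rwa [card_erase_of_mem hw, hk] at this
  have hEW : ∑ w ∈ nonNbrs G v, cov G v w ≤ 5 * 4 := by
    rw [← hk, ← smul_eq_mul]
    exact sum_le_card_nsmul _ _ _ hcw
  have hc : ∀ x, G.Adj v x → cov G v x ≤ 4 := fun x hx => by
    have := cov_lt_of_not_hasHIST hno (by omega) (by omega) hx
    omega
  have hsum := sum_cov_add_card_le (G := G) (v := v) (A := ∅) (by simp) hc (by simp)
  rw [card_empty] at hsum
  obtain ⟨u, hu, hu4⟩ : ∃ u, G.Adj v u ∧ 3 < cov G v u := by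
    by_contra! hall
    have h1 := sum_cov_add_card_le (G := G) (v := v) (A := ∅) (by simp) hall (by simp)
    rw [card_empty] at h1
    omega
  have hu4' : #{w ∈ nonNbrs G v | G.Adj u w} = 4 := le_antisymm (hc u hu) hu4
  have hsplit := card_filter_add_card_filter_not (s := nonNbrs G v) (fun w => G.Adj u w)
  obtain ⟨w, hB⟩ := card_eq_one.1 (show #{w ∈ nonNbrs G v | ¬G.Adj u w} = 1 by omega)
  have hw : w ∈ nonNbrs G v ∧ ¬G.Adj u w := by
    simpa [hB] using (mem_filter (s := nonNbrs G v) (p := fun w => ¬G.Adj u w) (a := w)).symm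
  have hcov : ∀ w' ∈ nonNbrs G v, w' ≠ w → G.Adj u w' := by
    intro w' hw' hne
    by_contra h
    have : w' ∈ ({w} : Finset V) := hB ▸ mem_filter.2 ⟨hw', h⟩
    exact hne (mem_singleton.1 this)
  obtain ⟨hiso, hone⟩ := structure_of_cov_erase hno (by omega) (by omega) hu hw.1 hcov
  by_cases hex : ∃ w' ∈ nonNbrs G v, G.Adj w' w
  · obtain ⟨w', hw', hadj⟩ := hex
    have h1 := hone w' hw' hadj
    have hI := isolated_bound' (common_subset w) hiso
    have hs := card_common_le (G := G) (v := v) w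
    have hrest : ∑ x ∈ ((nonNbrs G v).erase w).erase w', #(common G v x) ≤ 3 * G.degree v := by
      have h3 : #(((nonNbrs G v).erase w).erase w') = 3 := by
        rw [card_erase_of_mem (mem_erase.2 ⟨hadj.ne, hw'⟩), card_erase_of_mem hw.1, hk]
      rw [← h3, ← smul_eq_mul]
      exact sum_le_card_nsmul _ _ _ fun x _ => card_common_le x
    have hdec : ∑ x ∈ nonNbrs G v, #(common G v x) =
        #(common G v w) + (#(common G v w') + ∑ x ∈ ((nonNbrs G v).erase w).erase w',
          #(common G v x)) := by
      rw [add_sum_erase _ (fun x => #(common G v x)) (mem_erase.2 ⟨hadj.ne, hw'⟩),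
        add_sum_erase _ (fun x => #(common G v x)) hw.1]
    have h7 : G.degree v ≤ #(common G v w) + 7 := by omega
    have h6 : 2 * #(common G v w) * G.degree v ≤ 4 * G.degree v + 6 +
      #(common G v w) * #(common G v w) + #(common G v w) := by omega
    nlinarith
  · push Not at hex
    have h0 : cov G v w = 0 := by
      rw [cov, card_eq_zero, filter_eq_empty_iff]
      exact fun x hx h => hex x hx h.symm
    have h12 : ∑ x ∈ (nonNbrs G v).erase w, cov G v x ≤ 4 * 3 := by
      have h4 : #((nonNbrs G v).erase w) = 4 := by rw [card_erase_of_mem hw.1, hk]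
      rw [← h4, ← smul_eq_mul]
      refine sum_le_card_nsmul _ _ _ fun x hx => ?_
      have : {y ∈ nonNbrs G v | G.Adj x y} ⊆ ((nonNbrs G v).erase w).erase x := fun y hy => by
        rw [mem_filter] at hy
        refine mem_erase.2 ⟨hy.2.ne', mem_erase.2 ⟨?_, hy.1⟩⟩
        rintro rfl
        exact hex x (mem_of_mem_erase hx) hy.2
      have := card_le_card this
      rwa [card_erase_of_mem hx, h4] at this
    have := add_sum_erase (nonNbrs G v) (cov G v) hw.1
    omega

/-! ### At most one vertex outside the closed neighbourhood -/

lemma hasHIST_of_nonNbrs_eq_empty (hW : nonNbrs G v = ∅) (hN : 3 ≤ G.degree v) : HasHIST G := by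
  refine (grows_star_sdiff (G := G) (v := v) (X := ∅) (by simpa)).hasHIST_of_parts (v := v) (by simp)
    (by simp +contextual) (by simp [hW])

lemma mem_of_reachable {α : Type*} {H : SimpleGraph α} {P : α → Prop}
    (hP : ∀ x y, H.Adj x y → P x → P y) {x y : α} (h : H.Reachable x y) (hx : P x) : P y := by
  obtain ⟨p⟩ := h
  induction p with
  | nil => exact hx
  | cons hadj _ ih => exact ih (hP _ _ hadj hx)

/-- Without a HIST the neighbours of `w` are isolated inside the neighbourhood of `v`. If they are
all of it, the edges are too few; if not, deleting `v` cuts `w` and its neighbours off from the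
rest. -/
lemma hasHIST_of_nonNbrs_eq_singleton {w : V} (hW : nonNbrs G v = {w}) (hN : 6 ≤ G.degree v)
    (hconn : (G.induce {x : V | x ≠ v}).Connected)
    (hm : ∑ x ∈ G.neighborFinset v, coDeg G v x + 10 ≤
      4 * G.degree v + 2 * ∑ w ∈ nonNbrs G v, #(common G v w) + ∑ w ∈ nonNbrs G v, cov G v w) :
    HasHIST G := by
  have mW : ∀ x, x ≠ v → ¬G.Adj v x → x = w := fun x h h' => by
    have := mem_nonNbrs.2 ⟨h, h'⟩
    rwa [hW, mem_singleton] at this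
  have hw : w ≠ v ∧ ¬G.Adj v w := by rw [← mem_nonNbrs, hW]; simp
  by_contra hno
  have hiso : ∀ x ∈ common G v w, ∀ y, G.Adj v y → ¬G.Adj x y := by
    intro u hu x hx hux
    rw [mem_common] at hu
    have g0 := grows_star_sdiff (G := G) (v := v) (X := {x}) (by simp; omega)
    have g1 := g0.pair (u := u) (by simp [hu.1, hux.ne]) hu.2.symm hux (by simp [hw])
      (by simp [hx.ne']) (by rintro rfl; exact hw.2 hx)
    refine hno (g1.hasHIST_of_parts (v := v) (by simp) ?_ (by simp [hW]))
    intro y hy; by_cases h : y = x <;> simp [h, hy]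
  have hI := isolated_bound' (common_subset w) hiso
  have hle := card_common_le (G := G) (v := v) w
  have h0 : cov G v w = 0 := by simp [cov, hW, filter_singleton]
  rw [hW, sum_singleton, sum_singleton, h0] at hm
  by_cases hall : ∀ x, G.Adj v x → G.Adj w x
  · have : common G v w = G.neighborFinset v :=
      subset_antisymm (common_subset w) fun x hx => by
        rw [mem_neighborFinset] at hx
        exact mem_common.2 ⟨hx, hall x hx⟩
    rw [this, card_neighborFinset_eq_degree] at hI hm
    nlinarith
  · push Not at hall
    obtain ⟨x, hx, hwx⟩ := hall
    have hxv : x ≠ v := hx.ne'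
    have hreach := hconn.preconnected ⟨w, hw.1⟩ ⟨x, hxv⟩
    have := mem_of_reachable (P := fun y => y.1 = w ∨ y.1 ∈ common G v w) ?_ hreach (Or.inl rfl)
    · rcases this with h | h
      · exact hw.2 (h ▸ hx)
      · exact hwx (mem_common.1 h).2
    · rintro ⟨y, hy⟩ ⟨z, hz⟩ hyz hP
      have hyz : G.Adj y z := hyz
      by_cases hvz : G.Adj v z
      · rcases hP with rfl | hP
        · exact Or.inr (mem_common.2 ⟨hvz, hyz⟩)
        · exact (hiso y hP z hvz hyz).elim
      · exact Or.inl (mW z hz hvz)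

/-! ### Two vertices outside the closed neighbourhood, where B_n appears -/

/-- The path is `a`, `b`, `c`, attached to the clique at `d` and `e`. All other vertices are
interchangeable, so any bijection that extends the five labels works. -/
lemma iso_graphB {n : ℕ} (hn : Fintype.card V = n) (h5 : 5 ≤ n) {a b c d e : V} (hab : a ≠ b)
    (hac : a ≠ c) (had : a ≠ d) (hae : a ≠ e) (hbc : b ≠ c) (hbd : b ≠ d) (hbe : b ≠ e) (hcd : c ≠ d)
    (hce : c ≠ e) (hde : d ≠ e) (R : V → V → Prop)
    (hR : ∀ x y, R x y ↔ ((x ≠ a ∧ x ≠ b ∧ x ≠ c) ∧ (y ≠ a ∧ y ≠ b ∧ y ≠ c)) ∨ (x = a ∧ y = b) ∨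
      (x = b ∧ y = c) ∨ (x = a ∧ y = d) ∨ (x = c ∧ y = e))
    (hadj : ∀ x y, G.Adj x y ↔ x ≠ y ∧ (R x y ∨ R y x)) : Nonempty (G ≃g graphB n) := by
  let f : V → Fin n := fun x => if x = a then ⟨0, by omega⟩ else if x = b then ⟨1, by omega⟩
    else if x = c then ⟨2, by omega⟩ else if x = d then ⟨3, by omega⟩ else ⟨4, by omega⟩
  have fa : f a = ⟨0, by omega⟩ := by simp [f]
  have fb : f b = ⟨1, by omega⟩ := by simp [f, hab.symm]
  have fc : f c = ⟨2, by omega⟩ := by simp [f, hac.symm, hbc.symm]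
  have fd : f d = ⟨3, by omega⟩ := by simp [f, had.symm, hbd.symm, hcd.symm]
  have fe : f e = ⟨4, by omega⟩ := by simp [f, hae.symm, hbe.symm, hce.symm, hde.symm]
  obtain ⟨g, hg⟩ := Finset.exists_equiv_extend_of_card_eq (t := (univ : Finset (Fin n)))
    (by simp [hn]) (s := {a, b, c, d, e}) (f := f) (subset_univ _) (by
      intro x hx y hy hxy
      simp only [coe_insert, coe_singleton, Set.mem_insert_iff, Set.mem_singleton_iff] at hx hy
      rcases hx with rfl | rfl | rfl | rfl | rfl <;> rcases hy with rfl | rfl | rfl | rfl | rfl <;>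
        simp_all)
  let φ : V ≃ Fin n := g.trans (Equiv.subtypeUnivEquiv fun x => mem_univ x)
  have hφ : ∀ x ∈ ({a, b, c, d, e} : Finset V), φ x = f x := hg
  have key : ∀ {z : V} {k : ℕ} (hk : k < n), φ z = ⟨k, hk⟩ → ∀ x, (φ x).val = k ↔ x = z := by
    intro z k hk hz x
    rw [← φ.apply_eq_iff_eq, hz, Fin.ext_iff]
  have ka := key _ ((hφ a (by simp)).trans fa)
  have kb := key _ ((hφ b (by simp)).trans fb)
  have kc := key _ ((hφ c (by simp)).trans fc)
  have kd := key _ ((hφ d (by simp)).trans fd)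
  have ke := key _ ((hφ e (by simp)).trans fe)
  have k3 : ∀ x, 3 ≤ (φ x).val ↔ x ≠ a ∧ x ≠ b ∧ x ≠ c := by
    intro x
    rw [Ne, Ne, Ne, ← ka, ← kb, ← kc]
    omega
  refine ⟨φ, ?_⟩
  intro x y
  rw [hadj, graphB, fromRel_adj]
  simp only [ka, kb, kc, kd, ke, k3, hR, φ.injective.ne_iff]

lemma cov_pair {w₁ w₂ : V} (hW : nonNbrs G v = {w₁, w₂}) (h12 : w₁ ≠ w₂) (u : V) :
    cov G v u = (if G.Adj u w₁ then 1 else 0) + (if G.Adj u w₂ then 1 else 0) := by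
  rw [cov, hW, card_filter, sum_pair h12]

/-- The path is `u₂`, `w₂`, `w₁`; the clique consists of `v` and its neighbours other than `u₂`. The
end `u₂` is attached at `v`, the end `w₁` at `u₁`. -/
lemma iso_graphB_of_structure {n : ℕ} (hn : Fintype.card V = n) (h5 : 5 ≤ n) {w₁ w₂ u₁ u₂ : V}
    (hW : nonNbrs G v = {w₁, w₂}) (hw : G.Adj w₁ w₂) (h₁ : common G v w₁ = {u₁})
    (h₂ : common G v w₂ = {u₂}) (hu : u₁ ≠ u₂) (hiso : ∀ y, G.Adj v y → ¬G.Adj u₂ y)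
    (hcl : ∀ x y, G.Adj v x → G.Adj v y → x ≠ u₂ → y ≠ u₂ → x ≠ y → G.Adj x y) :
    Nonempty (G ≃g graphB n) := by
  have mW : ∀ x, x = v ∨ G.Adj v x ∨ x = w₁ ∨ x = w₂ := fun x => by
    by_cases hx : x = v
    · exact Or.inl hx
    · by_cases hx' : G.Adj v x
      · exact Or.inr (Or.inl hx')
      · have := mem_nonNbrs.2 ⟨hx, hx'⟩
        rw [hW] at this
        exact Or.inr (Or.inr (by simpa using this))
  have a1 : w₁ ≠ v ∧ ¬G.Adj v w₁ := by rw [← mem_nonNbrs, hW]; simp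
  have a2 : w₂ ≠ v ∧ ¬G.Adj v w₂ := by rw [← mem_nonNbrs, hW]; simp
  have c1 : ∀ x, G.Adj v x → (G.Adj w₁ x ↔ x = u₁) := fun x hx => by
    rw [← mem_singleton, ← h₁, mem_common]; tauto
  have c2 : ∀ x, G.Adj v x → (G.Adj w₂ x ↔ x = u₂) := fun x hx => by
    rw [← mem_singleton, ← h₂, mem_common]; tauto
  have v1 : G.Adj v u₁ := (mem_common.1 (h₁ ▸ mem_singleton_self u₁)).1
  have v2 : G.Adj v u₂ := (mem_common.1 (h₂ ▸ mem_singleton_self u₂)).1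
  have nw : ∀ {w x : V}, ¬G.Adj v w → G.Adj v x → w ≠ x := by rintro w x h h' rfl; exact h h'
  have hadj : ∀ x y, G.Adj x y ↔ x ≠ y ∧
      ((((x ≠ u₂ ∧ x ≠ w₂ ∧ x ≠ w₁) ∧ (y ≠ u₂ ∧ y ≠ w₂ ∧ y ≠ w₁)) ∨ (x = u₂ ∧ y = w₂) ∨
        (x = w₂ ∧ y = w₁) ∨ (x = u₂ ∧ y = v) ∨ (x = w₁ ∧ y = u₁)) ∨
      (((y ≠ u₂ ∧ y ≠ w₂ ∧ y ≠ w₁) ∧ (x ≠ u₂ ∧ x ≠ w₂ ∧ x ≠ w₁)) ∨ (y = u₂ ∧ x = w₂) ∨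
        (y = w₂ ∧ x = w₁) ∨ (y = u₂ ∧ x = v) ∨ (y = w₁ ∧ x = u₁))) := by
    have irr := fun x => G.irrefl (v := x)
    have com := G.adj_comm
    have := hw.symm
    intro x y
    rcases mW x with rfl | hx | rfl | rfl <;> rcases mW y with rfl | hy | rfl | rfl <;> grind
  exact iso_graphB hn h5 (a := u₂) (b := w₂) (c := w₁) (d := v) (e := u₁) (nw a2.2 v2).symm
    (nw a1.2 v2).symm v2.ne' hu.symm hw.ne' a2.1 (nw a2.2 v1) a1.1 (nw a1.2 v1) v1.ne _
    (fun _ _ => Iff.rfl) hadj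

lemma eq_of_mem_common_of_adj {w₁ w₂ : V} (hno : ¬HasHIST G) (hW : nonNbrs G v = {w₁, w₂})
    (hw : G.Adj w₁ w₂) (hN : 5 ≤ G.degree v) {u u' : V} (hu : u ∈ common G v w₁)
    (hu' : u' ∈ common G v w₁) (huu' : u ≠ u') {x : V} (hx : G.Adj v x) (hux : G.Adj u x) :
    x = u' := by
  rw [mem_common] at hu hu'
  by_contra h
  exact hno (hasHIST_of_two_adj hW hw hN hu.1 hu'.1 hx hu.2 hu'.2 hux huu' h)

/-- Isolated vertices are so expensive that `w₁` and `w₂` must be adjacent with one link each. The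
edge count is then attained with equality, which fixes the graph. -/
lemma hasHIST_or_iso_of_isolated {n : ℕ} (hn : Fintype.card V = n) {w₁ w₂ : V}
    (hW : nonNbrs G v = {w₁, w₂}) (h12 : w₁ ≠ w₂) (hN : 5 ≤ G.degree v) (hδ : ∀ u, 2 ≤ G.degree u)
    (hm : ∑ x ∈ G.neighborFinset v, coDeg G v x + 8 ≤
      2 * G.degree v + 2 * ∑ w ∈ nonNbrs G v, #(common G v w) + ∑ w ∈ nonNbrs G v, cov G v w)
    (hc : ∀ x, G.Adj v x → cov G v x ≤ 1)
    (hiso : ∀ x ∈ common G v w₂, ∀ y, G.Adj v y → ¬G.Adj x y) :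
    HasHIST G ∨ Nonempty (G ≃g graphB n) := by
  rw [or_iff_not_imp_left]
  intro hno
  have mW : ∀ x, x ∈ nonNbrs G v ↔ x = w₁ ∨ x = w₂ := by simp [hW]
  have q1 := (mW w₁).2 (by simp)
  have q2 := (mW w₂).2 (by simp)
  have hD := disjoint_common q1 q2 h12 hc
  have hsum := sum_cov_add_card_le (G := G) (v := v) (A := ∅) (by simp) hc (by simp)
  have d1 := degree_nonNbr q1
  have d2 := degree_nonNbr q2
  have l1 := hδ w₁
  have l2 := hδ w₂
  have hcard := card_eq_degree_add G v
  rw [hW, card_pair h12] at hcard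
  rw [hW, sum_pair h12, card_empty] at hsum
  rw [hW, sum_pair h12, sum_pair h12] at hm
  simp only [cov_pair hW h12, G.irrefl, if_false, G.adj_comm w₂ w₁] at hm d1 d2
  have hI := isolated_bound' (common_subset w₂) hiso
  have hI' : (∀ x ∈ common G v w₁, ∀ y, G.Adj v y → ¬G.Adj x y) →
      2 * (#(common G v w₁) + #(common G v w₂)) * G.degree v ≤
        ∑ x ∈ G.neighborFinset v, coDeg G v x + (#(common G v w₁) + #(common G v w₂)) *
          (#(common G v w₁) + #(common G v w₂)) + (#(common G v w₁) + #(common G v w₂)) := by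
    intro h
    rw [← card_union_of_disjoint hD]
    refine isolated_bound' (union_subset (common_subset _) (common_subset _)) fun x hx => ?_
    rcases mem_union.1 hx with hx | hx
    exacts [h x hx, hiso x hx]
  by_cases hw : G.Adj w₁ w₂
  swap
  · exfalso
    simp only [hw, if_false] at hm d1 d2
    obtain ⟨r, hr⟩ := Nat.exists_eq_add_of_le (show 2 ≤ #(common G v w₂) by omega)
    obtain ⟨t, ht⟩ := Nat.exists_eq_add_of_le (show #(common G v w₂) + 2 ≤ G.degree v by omega)
    rw [ht] at hI hm hsum
    rw [hr] at hI hm hsum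
    nlinarith
  simp only [hw, if_true] at hm d1 d2
  -- A third member supplies a `u'` different from both `x` and `y`.
  have hiso1 : 3 ≤ #(common G v w₁) → ∀ x ∈ common G v w₁, ∀ y, G.Adj v y → ¬G.Adj x y := by
    intro h3 x hx y hy hxy
    obtain ⟨u', hu', hne⟩ := exists_mem_ne (s := (common G v w₁).erase x)
      (by rw [card_erase_of_mem hx]; omega) y
    rw [mem_erase] at hu'
    exact hne (eq_of_mem_common_of_adj hno hW hw hN hx hu'.2 hu'.1.symm hy hxy).symm
  have hs2 : #(common G v w₂) ≤ 2 := by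
    by_contra! h
    obtain ⟨r, hr⟩ := Nat.exists_eq_add_of_le (show 3 ≤ #(common G v w₂) by omega)
    obtain ⟨t, ht⟩ := Nat.exists_eq_add_of_le (show #(common G v w₂) + 1 ≤ G.degree v by omega)
    rw [ht] at hI hm hsum
    rw [hr] at hI hm hsum
    nlinarith
  rcases Nat.lt_or_ge #(common G v w₂) 2 with h1 | h2
  swap
  · exfalso
    have e2 : #(common G v w₂) = 2 := by omega
    rw [e2] at hI hI' hm hsum
    have := hI' (hiso1 (by omega))
    have e1 : #(common G v w₁) + 2 = G.degree v := by omega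
    rw [e1] at this
    nlinarith
  have e2 : #(common G v w₂) = 1 := by omega
  rw [e2] at hI hI' hm hsum
  have hiso2 : ∀ u, G.Adj v u → u ∉ common G v w₂ →
      2 * G.degree v + 2 * coDeg G v u ≤ ∑ x ∈ G.neighborFinset v, coDeg G v x + 4 := by
    intro u hu hu2
    have := isolated_bound (common_subset w₂) hiso hu hu2
    rw [e2] at this
    omega
  rcases Nat.lt_or_ge #(common G v w₁) 3 with h3 | h3
  swap
  · exfalso
    have := hI' (hiso1 h3)
    obtain ⟨r, hr⟩ := Nat.exists_eq_add_of_le h3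
    obtain ⟨t, ht⟩ := Nat.exists_eq_add_of_le (show #(common G v w₁) + 1 ≤ G.degree v by omega)
    rw [ht] at this hm
    rw [hr] at this hm
    nlinarith
  rcases Nat.lt_or_ge #(common G v w₁) 2 with h2' | h2'
  swap
  -- Of two members, each has at most the other as a neighbour inside the neighbourhood of `v`. Its
  -- co-degree is then larger than `hiso2` permits.
  · exfalso
    have e1 : #(common G v w₁) = 2 := by omega
    obtain ⟨u, u', huu', hU⟩ := card_eq_two.1 e1
    have hu : u ∈ common G v w₁ := by rw [hU]; simp
    have hu' : u' ∈ common G v w₁ := by rw [hU]; simp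
    have hsub : common G v u ⊆ {u'} := fun x hx => by
      rw [mem_common] at hx
      exact mem_singleton.2 (eq_of_mem_common_of_adj hno hW hw hN hu hu' huu' hx.1 hx.2)
    have h5 := card_le_card hsub
    have h6 := card_common_add_coDeg (mem_common.1 hu).1
    have h7 := hiso2 u (mem_common.1 hu).1 (fun h => Finset.disjoint_left.1 hD hu h)
    rw [card_singleton] at h5
    omega
  obtain ⟨u₁, h₁⟩ := card_eq_one.1 (show #(common G v w₁) = 1 by omega)
  obtain ⟨u₂, h₂⟩ := card_eq_one.1 e2
  have hu₁ : u₁ ∈ common G v w₁ := by rw [h₁]; simp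
  have hu₂ : u₂ ∈ common G v w₂ := by rw [h₂]; simp
  have v2 := (mem_common.1 hu₂).1
  refine iso_graphB_of_structure hn (by omega) hW hw h₁ h₂
    (fun e => Finset.disjoint_left.1 hD hu₁ (e ▸ hu₂)) (hiso u₂ hu₂) ?_
  -- By `hm` the sum of `coDeg` is now at most twice the degree of `v` minus 2, so `hiso2` allows
  -- `x` a single non-neighbour, and `u₂` is already one.
  intro x y hx hy hx2 hy2 hxy
  by_contra hadj
  have h5 := hiso2 x hx (by rw [h₂, mem_singleton]; exact hx2)
  have h6 : 2 ≤ coDeg G v x := by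
    rw [← card_pair hy2]
    refine card_le_card fun z hz => ?_
    rw [mem_insert, mem_singleton] at hz
    simp only [mem_filter, mem_neighborFinset]
    rcases hz with rfl | rfl
    · exact ⟨hy, hxy.symm, hadj⟩
    · exact ⟨v2, hx2.symm, fun h => hiso z hu₂ x hx h.symm⟩
  omega

/-- If the members of a set `A` of neighbours of `v` have at most one neighbour among the neighbours
of `v`, then many pairs of neighbours of `v` are non-adjacent. -/
lemma sum_coDeg_ge_of_common_le_one {A : Finset V} (hA : A ⊆ G.neighborFinset v)
    (h1 : ∀ u ∈ A, #(common G v u) ≤ 1) :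
    #A * (G.degree v - #A) + #A * G.degree v ≤
      ∑ x ∈ G.neighborFinset v, coDeg G v x + 3 * #A ∧
    #A * G.degree v ≤ ∑ x ∈ G.neighborFinset v, coDeg G v x + 2 * #A := by
  have hAsum : #A * G.degree v ≤ ∑ x ∈ A, coDeg G v x + 2 * #A := by
    have : ∑ x ∈ A, G.degree v ≤ ∑ x ∈ A, (coDeg G v x + 2) := sum_le_sum fun x hx => by
      have := card_common_add_coDeg ((mem_neighborFinset ..).1 (hA hx))
      have := h1 x hx
      omega
    rw [sum_add_distrib, sum_const, sum_const, smul_eq_mul, smul_eq_mul] at this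
    omega
  have hsplit : ∑ x ∈ G.neighborFinset v, coDeg G v x =
      ∑ x ∈ G.neighborFinset v \ A, coDeg G v x + ∑ x ∈ A, coDeg G v x := (sum_sdiff hA).symm
  refine ⟨?_, by omega⟩
  have hle : ∑ x ∈ G.neighborFinset v \ A, #{u ∈ A | ¬G.Adj x u} ≤
      ∑ x ∈ G.neighborFinset v \ A, coDeg G v x := sum_le_sum fun x hx => by
    rw [mem_sdiff] at hx
    refine card_le_card fun u hu => ?_
    rw [mem_filter] at hu
    rw [mem_filter]
    exact ⟨hA hu.1, fun e => hx.2 (e ▸ hu.1), hu.2⟩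
  have hswap : ∑ x ∈ G.neighborFinset v \ A, #{u ∈ A | ¬G.Adj x u} =
      ∑ u ∈ A, #{x ∈ G.neighborFinset v \ A | ¬G.Adj x u} :=
    sum_card_bipartiteAbove_eq_sum_card_bipartiteBelow fun x u => ¬G.Adj x u
  have hge : #A * (G.degree v - #A) ≤
      ∑ u ∈ A, #{x ∈ G.neighborFinset v \ A | ¬G.Adj x u} + #A := by
    have : ∑ u ∈ A, (G.degree v - #A) ≤
        ∑ u ∈ A, (#{x ∈ G.neighborFinset v \ A | ¬G.Adj x u} + 1) := sum_le_sum fun u hu => by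
      have e1 := card_filter_add_card_filter_not (s := G.neighborFinset v \ A) (fun x => G.Adj x u)
      have e2 : #{x ∈ G.neighborFinset v \ A | G.Adj x u} ≤ 1 := by
        refine (card_le_card fun x hx => ?_).trans (h1 u hu)
        rw [mem_filter, mem_sdiff, mem_neighborFinset] at hx
        exact mem_common.2 ⟨hx.1.1, hx.2.symm⟩
      rw [card_sdiff_of_subset hA, card_neighborFinset_eq_degree] at e1
      omega
    rw [sum_add_distrib, sum_const, sum_const, smul_eq_mul, smul_eq_mul, mul_one] at this
    exact this
  omega

/-- `hasHIST_of_two`, used in both orders (`cross`), leaves each common neighbour of `v` with `w₁`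
or `w₂` at most one neighbour inside the neighbourhood of `v`. So many missing pairs contradict
`hm`. -/
lemma hasHIST_of_not_isolated {w₁ w₂ : V} (hW : nonNbrs G v = {w₁, w₂}) (h12 : w₁ ≠ w₂)
    (hN : 5 ≤ G.degree v) (hδ : ∀ u, 2 ≤ G.degree u)
    (hm : ∑ x ∈ G.neighborFinset v, coDeg G v x + 8 ≤
      2 * G.degree v + 2 * ∑ w ∈ nonNbrs G v, #(common G v w) + ∑ w ∈ nonNbrs G v, cov G v w)
    (hc : ∀ x, G.Adj v x → cov G v x ≤ 1) {u₁ u₂ x₁ x₂ : V} (hu₁ : u₁ ∈ common G v w₁)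
    (hu₂ : u₂ ∈ common G v w₂) (hx₁ : G.Adj v x₁) (hx₂ : G.Adj v x₂) (h₁ : G.Adj u₁ x₁)
    (h₂ : G.Adj u₂ x₂) : HasHIST G := by
  by_contra hno
  have mW : ∀ x, x ∈ nonNbrs G v ↔ x = w₁ ∨ x = w₂ := by simp [hW]
  have q1 := (mW w₁).2 (by simp)
  have q2 := (mW w₂).2 (by simp)
  have hD := disjoint_common q1 q2 h12 hc
  have hsum := sum_cov_add_card_le (G := G) (v := v) (A := ∅) (by simp) hc (by simp)
  have hW' : nonNbrs G v = {w₂, w₁} := by rw [hW, pair_comm]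
  have cross : ∀ {a b x y : V}, a ∈ common G v w₁ → b ∈ common G v w₂ → G.Adj v x → G.Adj v y →
      G.Adj a x → G.Adj b y → x ≠ y → y = a ∧ x = b := by
    intro a b x y ha hb hx hy hax hby hxy
    rw [mem_common] at ha hb
    constructor
    · by_contra h
      exact hno (hasHIST_of_two hW h12 hN ha.1 hb.1 hx hy ha.2.symm hb.2.symm hax hby hxy h)
    · by_contra h
      exact hno (hasHIST_of_two hW' h12.symm hN hb.1 ha.1 hy hx hb.2.symm ha.2.symm hby hax hxy.symm
        h)
  have c1 : ∀ u ∈ common G v w₁, #(common G v u) ≤ 1 := by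
    intro u hu
    refine card_le_one.2 fun y hy y' hy' => ?_
    rw [mem_common] at hy hy'
    by_contra hne
    by_cases h : y = x₂
    · have h3 := cross hu hu₂ hy'.1 hx₂ hy'.2 h₂ (fun e => hne (h.trans e.symm))
      exact hy.2.ne (h3.1.symm.trans h.symm)
    · have h3 := cross hu hu₂ hy.1 hx₂ hy.2 h₂ h
      by_cases h' : y' = x₂
      · exact hy'.2.ne (h3.1.symm.trans h'.symm)
      · exact hne (h3.2.trans (cross hu hu₂ hy'.1 hx₂ hy'.2 h₂ h').2.symm)
  have c2 : ∀ u ∈ common G v w₂, #(common G v u) ≤ 1 := by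
    intro u hu
    refine card_le_one.2 fun y hy y' hy' => ?_
    rw [mem_common] at hy hy'
    by_contra hne
    by_cases h : x₁ = y
    · have h3 := cross hu₁ hu hx₁ hy'.1 h₁ hy'.2 (fun e => hne (h.symm.trans e))
      exact hy.2.ne (h3.2.symm.trans h)
    · have h3 := cross hu₁ hu hx₁ hy.1 h₁ hy.2 h
      by_cases h' : x₁ = y'
      · exact hy'.2.ne (h3.2.symm.trans h')
      · exact hne (h3.1.trans (cross hu₁ hu hx₁ hy'.1 h₁ hy'.2 h').1.symm)
  have hM := sum_coDeg_ge_of_common_le_one (G := G) (v := v)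
    (A := common G v w₁ ∪ common G v w₂) (union_subset (common_subset _) (common_subset _))
    (by
      intro u hu
      rcases mem_union.1 hu with hu | hu
      exacts [c1 u hu, c2 u hu])
  rw [card_union_of_disjoint hD] at hM
  have d1 := degree_nonNbr q1
  have d2 := degree_nonNbr q2
  have l1 := hδ w₁
  have l2 := hδ w₂
  rw [hW, sum_pair h12, card_empty] at hsum
  rw [hW, sum_pair h12, sum_pair h12] at hm
  simp only [cov_pair hW h12, G.irrefl, if_false, G.adj_comm w₂ w₁] at hm d1 d2
  by_cases hw : G.Adj w₁ w₂
  · simp only [hw, if_true] at hm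
    -- A second member `u'` would equal `x₁`. If `x₁ = x₂`, it has the two neighbours `u₁` and `u₂`,
    -- against `c1`; if not, `cross` gives `x₁ = u₂`, against disjointness.
    have s1 : #(common G v w₁) ≤ 1 := by
      by_contra! h
      obtain ⟨u', hu', hne⟩ := exists_mem_ne h u₁
      have e : x₁ = u' := eq_of_mem_common_of_adj hno hW hw hN hu₁ hu' hne.symm hx₁ h₁
      have h5 : x₁ ≠ x₂ := by
        intro e'
        have := card_le_one.1 (c1 u' hu') u₁ (mem_common.2 ⟨(mem_common.1 hu₁).1, e ▸ h₁.symm⟩) u₂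
          (mem_common.2 ⟨(mem_common.1 hu₂).1, e ▸ e' ▸ h₂.symm⟩)
        exact Finset.disjoint_left.1 hD hu₁ (this ▸ hu₂)
      have h6 := (cross hu₁ hu₂ hx₁ hx₂ h₁ h₂ h5).2
      exact Finset.disjoint_left.1 hD hu' (e ▸ h6 ▸ hu₂)
    have s2 : #(common G v w₂) ≤ 1 := by
      by_contra! h
      obtain ⟨u', hu', hne⟩ := exists_mem_ne h u₂
      have e : x₂ = u' := eq_of_mem_common_of_adj hno hW' hw.symm hN hu₂ hu' hne.symm hx₂ h₂
      have h5 : x₁ ≠ x₂ := by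
        intro e'
        have := card_le_one.1 (c2 u' hu') u₂ (mem_common.2 ⟨(mem_common.1 hu₂).1, e ▸ h₂.symm⟩) u₁
          (mem_common.2 ⟨(mem_common.1 hu₁).1, e ▸ e' ▸ h₁.symm⟩)
        exact Finset.disjoint_left.1 hD hu₁ (this ▸ hu₂)
      have h6 := (cross hu₁ hu₂ hx₁ hx₂ h₁ h₂ h5).1
      exact Finset.disjoint_left.1 hD hu₁ (h6 ▸ e ▸ hu')
    have p1 : 0 < #(common G v w₁) := card_pos.2 ⟨_, hu₁⟩
    have p2 : 0 < #(common G v w₂) := card_pos.2 ⟨_, hu₂⟩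
    have e1 : #(common G v w₁) = 1 := by omega
    have e2 : #(common G v w₂) = 1 := by omega
    rw [e1, e2] at hM hm
    omega
  · simp only [hw, if_false] at hm d1 d2
    set a := #(common G v w₁) + #(common G v w₂) with ha
    obtain ⟨hM1, hM2⟩ := hM
    have haN : a ≤ G.degree v := by omega
    have ha4 : 4 ≤ a := by omega
    have hm2 : ∑ x ∈ G.neighborFinset v, coDeg G v x + 8 ≤ 2 * G.degree v + 2 * a := by omega
    rcases haN.eq_or_lt with e | hlt
    · rw [e] at hM2 hm2
      nlinarith
    · obtain ⟨t, ht⟩ := Nat.exists_eq_add_of_lt hlt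
      have e : G.degree v - a = t + 1 := by omega
      rw [e, ht] at hM1
      rw [ht] at hm2
      nlinarith

lemma hasHIST_or_iso_of_card_nonNbrs_eq_two {n : ℕ} (hn : Fintype.card V = n)
    (hk : #(nonNbrs G v) = 2) (hN : 5 ≤ G.degree v) (hδ : ∀ u, 2 ≤ G.degree u)
    (hm : ∑ x ∈ G.neighborFinset v, coDeg G v x + 8 ≤
      2 * G.degree v + 2 * ∑ w ∈ nonNbrs G v, #(common G v w) + ∑ w ∈ nonNbrs G v, cov G v w) :
    HasHIST G ∨ Nonempty (G ≃g graphB n) := by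
  by_cases hno : HasHIST G
  · exact Or.inl hno
  have hc : ∀ x, G.Adj v x → cov G v x ≤ 1 := fun x hx => by
    have := cov_lt_of_not_hasHIST hno (by omega) (by omega) hx
    omega
  obtain ⟨w₁, w₂, h12, hW⟩ := card_eq_two.1 hk
  by_cases i2 : ∀ x ∈ common G v w₂, ∀ y, G.Adj v y → ¬G.Adj x y
  · exact hasHIST_or_iso_of_isolated hn hW h12 hN hδ hm hc i2
  by_cases i1 : ∀ x ∈ common G v w₁, ∀ y, G.Adj v y → ¬G.Adj x y
  · exact hasHIST_or_iso_of_isolated hn (by rw [hW, pair_comm]) h12.symm hN hδ hm hc i1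
  push Not at i1 i2
  obtain ⟨u₁, hu₁, x₁, hx₁, h₁⟩ := i1
  obtain ⟨u₂, hu₂, x₂, hx₂, h₂⟩ := i2
  exact Or.inl (hasHIST_of_not_isolated hW h12 hN hδ hm hc hu₁ hu₂ hx₁ hx₂ h₁ h₂)

end Cases

/-! ### The edge version of the theorem -/

section Main

variable {V : Type*} [Fintype V]

/-- Deleting the only possible neighbour `x` of `u` would separate `u` from a third vertex. -/
lemma IsTwoConnected.two_le_degree {G : SimpleGraph V} [DecidableRel G.Adj] (hG : IsTwoConnected G)
    (u : V) : 2 ≤ G.degree u := by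
  classical
  by_contra! h
  have hx : ∃ x, x ≠ u ∧ ∀ y, G.Adj u y → y = x := by
    rcases Nat.eq_zero_or_pos (G.degree u) with h0 | h1
    · have : 1 < Fintype.card V := by have := hG.1; omega
      obtain ⟨x, hx⟩ := Fintype.exists_ne_of_one_lt_card this u
      refine ⟨x, hx, fun y hy => ?_⟩
      have := (G.mem_neighborFinset u y).2 hy
      rw [← card_neighborFinset_eq_degree, card_eq_zero] at h0
      simp [h0] at this
    · obtain ⟨x, hx⟩ := card_eq_one.1 (show #(G.neighborFinset u) = 1 by
        rw [card_neighborFinset_eq_degree]; omega)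
      have hux : G.Adj u x := by rw [← mem_neighborFinset, hx]; simp
      refine ⟨x, hux.ne', fun y hy => ?_⟩
      rwa [← mem_neighborFinset, hx, mem_singleton] at hy
  obtain ⟨x, hxu, hx⟩ := hx
  obtain ⟨y, hy⟩ : ∃ y, y ∉ ({u, x} : Finset V) := by
    by_contra! hall
    have := card_le_card (subset_univ (α := V) {u, x} |>.antisymm fun y _ => hall y).symm.subset
    rw [card_univ] at this
    have h2 := card_le_two (a := u) (b := x)
    have := hG.1
    omega
  simp only [mem_insert, mem_singleton, not_or] at hy
  have hr := (hG.2.2 x).preconnected ⟨u, hxu.symm⟩ ⟨y, hy.2⟩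
  refine hy.1 (mem_of_reachable (P := fun z => z.1 = u) ?_ hr rfl)
  rintro ⟨a, ha⟩ ⟨b, hb⟩ hab rfl
  exact (hb (hx b hab)).elim

/-- A 2-connected graph with at least as many edges as `B_n` has a HIST or is `B_n`. -/
theorem IsTwoConnected.hasHIST_or_iso {G : SimpleGraph V} [DecidableRel G.Adj]
    (hG : IsTwoConnected G) {n : ℕ} (hn : Fintype.card V = n) (h8 : 8 ≤ n)
    (hm : n * n + 20 ≤ 2 * #G.edgeFinset + 7 * n) :
    HasHIST G ∨ Nonempty (G ≃g graphB n) := by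
  classical
  have hδ := hG.two_le_degree
  have : Nonempty V := Fintype.card_pos_iff.1 (by omega)
  obtain ⟨v, hmax⟩ := Finite.exists_max fun u => G.degree u
  have hcard := card_eq_degree_add G v
  have hcount := two_mul_edges G v
  have hdeg : 2 * #G.edgeFinset ≤ n * G.degree v := by
    rw [← sum_degrees_eq_twice_card_edges, ← hn, ← card_univ, ← smul_eq_mul]
    exact sum_le_card_nsmul _ _ _ fun u _ => hmax u
  generalize hN : G.degree v = N at *
  generalize hk : #(nonNbrs G v) = k at *
  have hnk : n = N + 1 + k := by omega
  -- From n² - 7n + 20 ≤ 2m ≤ n(n - 1 - k) follows (6 - k)n ≥ 20. The same inequality gives the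
  -- lower bounds on `N` for k = 4 and k = 5 below.
  have hk6 : k < 6 := by
    by_contra! h
    nlinarith
  subst hnk
  interval_cases k
  · exact Or.inl (hasHIST_of_nonNbrs_eq_empty (card_eq_zero.1 hk) (by omega))
  · obtain ⟨w, hW⟩ := card_eq_one.1 hk
    exact Or.inl (hasHIST_of_nonNbrs_eq_singleton hW (by omega) (hG.2.2 v) (by rw [hN]; nlinarith))
  · exact hasHIST_or_iso_of_card_nonNbrs_eq_two hn hk (by omega) hδ (by rw [hN]; nlinarith)
  · exact Or.inl (hasHIST_of_card_nonNbrs_eq_three hk (by omega) (by rwa [hN]) hδ (by nlinarith))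
  · exact Or.inl (hasHIST_of_card_nonNbrs_eq_four hk (by nlinarith) (by rwa [hN]) hδ
      (by rw [hN]; nlinarith))
  · exact Or.inl (hasHIST_of_card_nonNbrs_eq_five hk (by nlinarith) (by rwa [hN])
      (by rw [hN]; nlinarith))

end Main

/-! ### Spectral radius: variational bounds and the row-sum estimate -/

section Spectral

open Classical in
lemma hasEigenvalue_iff {V : Type*} [Fintype V] {A : Matrix V V ℝ} {μ : ℝ} :
    Module.End.HasEigenvalue (Matrix.toLin' A) μ ↔ ∃ x : V → ℝ, x ≠ 0 ∧ A *ᵥ x = μ • x := by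
  constructor
  · intro h
    obtain ⟨x, hx⟩ := h.exists_hasEigenvector
    exact ⟨x, hx.2, by simpa using hx.apply_eq_smul⟩
  · rintro ⟨x, hx, h⟩
    refine Module.End.hasEigenvalue_of_hasEigenvector (x := x) ⟨?_, hx⟩
    rw [Module.End.mem_eigenspace_iff]
    simpa using h

open Classical in
lemma finite_eigenvalues {V : Type*} [Fintype V] (A : Matrix V V ℝ) :
    {μ : ℝ | Module.End.HasEigenvalue (Matrix.toLin' A) μ}.Finite :=
  Module.End.finite_hasEigenvalue _

open Classical in
lemma hasEigenvalue_spectralRadius {V : Type*} [Fintype V] [Nonempty V] (G : SimpleGraph V) :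
    Module.End.HasEigenvalue (Matrix.toLin' (G.adjMatrix ℝ)) (spectralRadius G) := by
  refine Set.Nonempty.csSup_mem ?_ (finite_eigenvalues _)
  have hA : (G.adjMatrix ℝ).IsHermitian := by
    rw [Matrix.IsHermitian, conjTranspose_eq_transpose_of_trivial, transpose_adjMatrix]
  obtain ⟨i⟩ := ‹Nonempty V›
  refine ⟨hA.eigenvalues i, hasEigenvalue_iff.2 ⟨_, ?_, hA.mulVec_eigenvectorBasis i⟩⟩
  intro h
  exact hA.eigenvectorBasis.orthonormal.ne_zero i (by ext j; exact congrFun h j)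

open Classical in
-- With A the adjacency matrix and ρ its spectral radius, an eigenvalue t of ρI - A makes ρ - t an
-- eigenvalue of A, hence at most ρ.
lemma posSemidef_spectralRadius {V : Type*} [Fintype V] (G : SimpleGraph V) :
    (spectralRadius G • (1 : Matrix V V ℝ) - G.adjMatrix ℝ).PosSemidef := by
  have hB : (spectralRadius G • (1 : Matrix V V ℝ) - G.adjMatrix ℝ).IsHermitian := by
    rw [Matrix.IsHermitian, conjTranspose_eq_transpose_of_trivial, transpose_sub, transpose_smul,
      transpose_one, transpose_adjMatrix]
  rw [hB.posSemidef_iff_eigenvalues_nonneg]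
  intro i
  have h := hB.mulVec_eigenvectorBasis i
  set y : V → ℝ := ⇑(hB.eigenvectorBasis i) with hy
  have hy0 : y ≠ 0 := fun h =>
    hB.eigenvectorBasis.orthonormal.ne_zero i (by ext j; exact congrFun h j)
  rw [sub_mulVec, smul_mulVec, one_mulVec] at h
  have hev : Module.End.HasEigenvalue (Matrix.toLin' (G.adjMatrix ℝ))
      (spectralRadius G - hB.eigenvalues i) := by
    refine hasEigenvalue_iff.2 ⟨y, hy0, ?_⟩
    rw [sub_smul, ← h, sub_sub_cancel]
  have := le_csSup (finite_eigenvalues (G.adjMatrix ℝ)).bddAbove hev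
  change spectralRadius G - hB.eigenvalues i ≤ spectralRadius G at this
  change 0 ≤ hB.eigenvalues i
  linarith

open Classical in
lemma dotProduct_mulVec_le_spectralRadius {V : Type*} [Fintype V] (G : SimpleGraph V) (x : V → ℝ) :
    x ⬝ᵥ (G.adjMatrix ℝ *ᵥ x) ≤ spectralRadius G * (x ⬝ᵥ x) := by
  have h := (posSemidef_spectralRadius G).dotProduct_mulVec_nonneg x
  rw [star_trivial, sub_mulVec, smul_mulVec, one_mulVec, dotProduct_sub, dotProduct_smul,
    smul_eq_mul] at h
  linarith

open Classical in
-- Passing to absolute values does not lower the Rayleigh quotient, so |y| attains the maximum and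
-- lies in the kernel of the positive semidefinite matrix ρI - A.
lemma exists_nonneg_eigenvector {V : Type*} [Fintype V] [Nonempty V] (G : SimpleGraph V) :
    ∃ x : V → ℝ, x ≠ 0 ∧ (∀ i, 0 ≤ x i) ∧ G.adjMatrix ℝ *ᵥ x = spectralRadius G • x := by
  obtain ⟨y, hy, hAy⟩ := hasEigenvalue_iff.1 (hasEigenvalue_spectralRadius G)
  refine ⟨fun i => |y i|, ?_, fun i => abs_nonneg _, ?_⟩
  · intro h
    exact hy (funext fun i => abs_eq_zero.1 (congrFun h i))
  · set x : V → ℝ := fun i => |y i| with hx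
    have hxx : x ⬝ᵥ x = y ⬝ᵥ y := by simp [dotProduct, hx]
    have h1 : y ⬝ᵥ (G.adjMatrix ℝ *ᵥ y) ≤ x ⬝ᵥ (G.adjMatrix ℝ *ᵥ x) := by
      simp only [dotProduct, mulVec, mul_sum]
      refine sum_le_sum fun i _ => sum_le_sum fun j _ => ?_
      have h0 : (0 : ℝ) ≤ G.adjMatrix ℝ i j := by rw [adjMatrix_apply]; split_ifs <;> simp
      calc y i * (G.adjMatrix ℝ i j * y j) = G.adjMatrix ℝ i j * (y i * y j) := by ring
        _ ≤ G.adjMatrix ℝ i j * |y i * y j| := mul_le_mul_of_nonneg_left (le_abs_self _) h0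
        _ = x i * (G.adjMatrix ℝ i j * x j) := by rw [abs_mul]; ring
    rw [hAy, dotProduct_smul, smul_eq_mul, ← hxx] at h1
    have h2 := dotProduct_mulVec_le_spectralRadius G x
    have h3 := ((posSemidef_spectralRadius G).dotProduct_mulVec_zero_iff x).1 (by
      rw [star_trivial, sub_mulVec, smul_mulVec, one_mulVec, dotProduct_sub, dotProduct_smul,
        smul_eq_mul]
      linarith)
    rw [sub_mulVec, smul_mulVec, one_mulVec, sub_eq_zero] at h3
    exact h3.symm

/-- An upper bound for the spectral radius of a graph without vertices of degree less than two. -/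
lemma spectralRadius_bound {V : Type*} [Fintype V] [Nonempty V] (G : SimpleGraph V)
    [DecidableRel G.Adj] (hδ : ∀ u, 2 ≤ G.degree u) :
    spectralRadius G ^ 2 - spectralRadius G ≤
      2 * (#G.edgeFinset : ℝ) - 2 * ((Fintype.card V : ℝ) - 1) := by
  classical
  obtain ⟨x, hx0, hx, hAx⟩ := exists_nonneg_eigenvector G
  set ρ := spectralRadius G
  have hA : ∀ v, ∑ u ∈ G.neighborFinset v, x u = ρ * x v := fun v => by
    have := congrFun hAx v
    rw [adjMatrix_mulVec_apply, Pi.smul_apply, smul_eq_mul] at this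
    rw [← this]
    exact sum_congr (by ext; simp) fun _ _ => rfl
  have hswap : ∀ f : V → ℝ, ∑ v, f v * (ρ * x v) = ∑ u, x u * ∑ v ∈ G.neighborFinset u, f v := by
    intro f
    simp only [← hA, mul_sum]
    rw [sum_comm' (t' := univ) (s' := fun u => G.neighborFinset u)]
    · exact sum_congr rfl fun u _ => sum_congr rfl fun v _ => mul_comm _ _
    · intro a b; simp [G.adj_comm]
  have hS : ρ * ∑ v, x v = ∑ u, x u * (G.degree u : ℝ) := by
    have := hswap fun _ => 1
    simpa [mul_sum] using this
  have hS2 : ρ ^ 2 * ∑ v, x v = ∑ u, x u * ∑ v ∈ G.neighborFinset u, (G.degree v : ℝ) := by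
    rw [← hswap, pow_two, mul_assoc, hS, mul_sum]
    exact sum_congr rfl fun _ _ => by ring
  -- The row sum of A² - A at `u`. In the total degree 2m, the n - 1 - d(u) vertices outside the
  -- closed neighbourhood contribute at least 2 each, after which d(u) cancels.
  have hrow : ∀ u, ∑ v ∈ G.neighborFinset u, (G.degree v : ℝ) - G.degree u ≤
      2 * (#G.edgeFinset : ℝ) - 2 * ((Fintype.card V : ℝ) - 1) := by
    intro u
    have hu : u ∉ G.neighborFinset u := by simp
    have h1 : ∑ v ∈ univ \ insert u (G.neighborFinset u), 2 ≤
        ∑ v ∈ univ \ insert u (G.neighborFinset u), G.degree v := sum_le_sum fun v _ => hδ v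
    have h2 := sum_sdiff (f := fun v => G.degree v) (subset_univ (insert u (G.neighborFinset u)))
    rw [sum_insert hu, sum_degrees_eq_twice_card_edges] at h2
    have h3 := card_sdiff_add_card_eq_card (subset_univ (insert u (G.neighborFinset u)))
    rw [card_insert_of_notMem hu, card_neighborFinset_eq_degree, card_univ] at h3
    rw [sum_const, smul_eq_mul] at h1
    have h4 : ∑ v ∈ G.neighborFinset u, G.degree v + 2 * Fintype.card V ≤
        2 * #G.edgeFinset + G.degree u + 2 := by omega
    have h5 : (∑ v ∈ G.neighborFinset u, (G.degree v : ℝ)) + 2 * Fintype.card V ≤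
        2 * #G.edgeFinset + G.degree u + 2 := by exact_mod_cast h4
    linarith
  have hpos : 0 < ∑ v, x v := by
    obtain ⟨i, hi⟩ := Function.ne_iff.1 hx0
    exact sum_pos' (fun v _ => hx v) ⟨i, mem_univ _, lt_of_le_of_ne (hx i) (Ne.symm hi)⟩
  refine le_of_mul_le_mul_right ?_ hpos
  rw [sub_mul, hS2, hS, ← sum_sub_distrib, mul_sum]
  refine sum_le_sum fun u _ => ?_
  rw [← mul_sub, mul_comm]
  exact mul_le_mul_of_nonneg_right (hrow u) (hx u)

lemma spectralRadius_le_of_iso {V W : Type*} [Fintype V] [Fintype W] [Nonempty V]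
    {G : SimpleGraph V} {H : SimpleGraph W} (e : G ≃g H) :
    spectralRadius G ≤ spectralRadius H := by
  classical
  obtain ⟨x, hx0, hx⟩ := hasEigenvalue_iff.1 (hasEigenvalue_spectralRadius G)
  refine le_csSup (finite_eigenvalues _).bddAbove (hasEigenvalue_iff.2 ⟨x ∘ e.symm, ?_, ?_⟩)
  · intro h
    refine hx0 (funext fun i => ?_)
    simpa using congrFun h (e i)
  · ext j
    have h := congrFun hx (e.symm j)
    simp only [mulVec, dotProduct, adjMatrix_apply, Pi.smul_apply, Function.comp_apply] at h ⊢
    rw [← h, ← e.toEquiv.sum_comp]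
    refine sum_congr rfl fun i _ => ?_
    have : H.Adj j (e i) ↔ G.Adj (e.symm j) i := by
      rw [← e.map_adj_iff, e.apply_symm_apply]
    simp [this]

lemma spectralRadius_eq_of_iso {V W : Type*} [Fintype V] [Fintype W] [Nonempty V]
    {G : SimpleGraph V} {H : SimpleGraph W} (e : G ≃g H) :
    spectralRadius G = spectralRadius H := by
  have : Nonempty W := e.toEquiv.nonempty_congr.1 inferInstance
  exact le_antisymm (spectralRadius_le_of_iso e) (spectralRadius_le_of_iso e.symm)

end Spectral

/-! ### Properties of B_n -/

section GraphB

variable {n : ℕ}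

lemma graphB_adj {i j : Fin n} : (graphB n).Adj i j ↔ i.val ≠ j.val ∧
    ((3 ≤ i.val ∧ 3 ≤ j.val) ∨ (i.val = 0 ∧ j.val = 1) ∨ (i.val = 1 ∧ j.val = 2) ∨
      (i.val = 0 ∧ j.val = 3) ∨ (i.val = 2 ∧ j.val = 4) ∨ (j.val = 0 ∧ i.val = 1) ∨
      (j.val = 1 ∧ i.val = 2) ∨ (j.val = 0 ∧ i.val = 3) ∨ (j.val = 2 ∧ i.val = 4)) := by
  rw [graphB, fromRel_adj, Ne, Fin.ext_iff]
  constructor <;> intro h <;> omega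

lemma connected_of_hub {α : Type*} {H : SimpleGraph α} (h : α) (hr : ∀ x, H.Reachable x h) :
    H.Connected :=
  have : Nonempty α := ⟨h⟩
  ⟨fun x y => (hr x).trans (hr y).symm⟩

lemma graphB_isTwoConnected (hn : 5 ≤ n) : IsTwoConnected (graphB n) := by
  refine ⟨by rw [Fintype.card_fin]; omega, ?_, ?_⟩
  · have r : ∀ a b (ha : a < n) (hb : b < n), (graphB n).Adj ⟨a, ha⟩ ⟨b, hb⟩ →
        (graphB n).Reachable ⟨a, ha⟩ ⟨b, hb⟩ := fun _ _ _ _ h => h.reachable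
    have r0 := r 0 3 (by omega) (by omega) (by simp [graphB_adj])
    have r1 := (r 1 0 (by omega) (by omega) (by simp [graphB_adj])).trans r0
    have r4 := r 4 3 (by omega) (by omega) (by simp [graphB_adj])
    have r2 := (r 2 4 (by omega) (by omega) (by simp [graphB_adj])).trans r4
    refine connected_of_hub ⟨3, by omega⟩ fun ⟨x, hx⟩ => ?_
    rcases Nat.lt_or_ge x 3 with h | h
    · interval_cases x <;> assumption
    · rcases h.eq_or_lt with rfl | h'
      · exact Reachable.refl _
      · exact r x 3 _ _ (by simp [graphB_adj]; omega)
  · intro v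
    have r : ∀ a b (ha : a < n) (hb : b < n) (ha' : (⟨a, ha⟩ : Fin n) ≠ v)
        (hb' : (⟨b, hb⟩ : Fin n) ≠ v), (graphB n).Adj ⟨a, ha⟩ ⟨b, hb⟩ →
        ((graphB n).induce {w : Fin n | w ≠ v}).Reachable ⟨⟨a, ha⟩, ha'⟩ ⟨⟨b, hb⟩, hb'⟩ :=
      fun _ _ _ _ _ _ h => Adj.reachable (G := (graphB n).induce {w : Fin n | w ≠ v}) h
    obtain ⟨v, hv⟩ := v
    simp only [ne_eq, Fin.mk.injEq] at r
    -- Every remaining vertex is joined to vertex 3, or to vertex 4 if 3 is the deleted one.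
    by_cases h3 : v = 3
    · subst h3
      refine connected_of_hub ⟨⟨4, by omega⟩, by simp⟩ fun ⟨⟨x, hx⟩, hxv⟩ => ?_
      have hxv : x ≠ 3 := by simpa using hxv
      have r2 := r 2 4 (by omega) (by omega) (by omega) (by omega) (by simp [graphB_adj])
      have r1 := (r 1 2 (by omega) (by omega) (by omega) (by omega) (by simp [graphB_adj])).trans r2
      have r0 := (r 0 1 (by omega) (by omega) (by omega) (by omega) (by simp [graphB_adj])).trans r1
      rcases Nat.lt_or_ge x 3 with h | h
      · interval_cases x <;> assumption
      · by_cases h4 : x = 4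
        · subst h4; exact Reachable.refl _
        · exact r x 4 _ _ hxv (by omega) (by simp [graphB_adj]; omega)
    · refine connected_of_hub ⟨⟨3, by omega⟩, by simpa using Ne.symm h3⟩ fun ⟨⟨x, hx⟩, hxv⟩ => ?_
      have hxv : x ≠ v := by simpa using hxv
      have r0 := fun h => r 0 3 (by omega) (by omega) h (Ne.symm h3) (by simp [graphB_adj])
      have r4 := fun h => r 4 3 (by omega) (by omega) h (Ne.symm h3) (by simp [graphB_adj])
      rcases Nat.lt_or_ge x 3 with h | h
      · interval_cases x
        · exact r0 hxv
        · by_cases hv0 : v = 0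
          · exact ((r 1 2 (by omega) (by omega) hxv (by omega) (by simp [graphB_adj])).trans
              (r 2 4 (by omega) (by omega) (by omega) (by omega) (by simp [graphB_adj]))).trans
              (r4 (by omega))
          · exact (r 1 0 (by omega) (by omega) hxv (by omega) (by simp [graphB_adj])).trans
              (r0 (by omega))
        · by_cases hv4 : v = 4
          · exact ((r 2 1 (by omega) (by omega) hxv (by omega) (by simp [graphB_adj])).trans
              (r 1 0 (by omega) (by omega) (by omega) (by omega) (by simp [graphB_adj]))).trans
              (r0 (by omega))
          · exact (r 2 4 (by omega) (by omega) hxv (by omega) (by simp [graphB_adj])).trans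
              (r4 (by omega))
      · rcases h.eq_or_lt with rfl | h'
        · exact Reachable.refl _
        · exact r x 3 _ _ hxv (Ne.symm h3) (by simp [graphB_adj]; omega)

/-- Two adjacent vertices that both have degree at most two in the ambient graph cannot be adjacent
in a larger spanning tree without vertices of degree two. -/
lemma not_adj_of_neighborSet_subset {α : Type*} {T : SimpleGraph α} (hT : T.Connected)
    (h2 : ∀ v, (T.neighborSet v).ncard ≠ 2) {a b c d y : α} (ha : T.neighborSet a ⊆ {b, c})
    (hb : T.neighborSet b ⊆ {a, d}) (hbc : b ≠ c) (had : a ≠ d) (hya : y ≠ a) (hyb : y ≠ b) :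
    ¬T.Adj a b := by
  intro hab
  have hac : ¬T.Adj a c := fun h => h2 a <| by
    rw [ha.antisymm (Set.insert_subset hab (Set.singleton_subset_iff.2 h)), Set.ncard_pair hbc]
  have hbd : ¬T.Adj b d := fun h => h2 b <| by
    rw [hb.antisymm (Set.insert_subset hab.symm (Set.singleton_subset_iff.2 h)), Set.ncard_pair had]
  have := mem_of_reachable (P := fun z => z = a ∨ z = b) ?_ (hT.preconnected a y) (Or.inl rfl)
  · exact this.elim hya hyb
  · rintro x z hxz (rfl | rfl)
    · rcases ha hxz with rfl | rfl
      exacts [Or.inr rfl, (hac hxz).elim]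
    · rcases hb hxz with rfl | rfl
      exacts [Or.inl rfl, (hbd hxz).elim]

/-- In a HIST the vertices 0, 1, 2 of degree two in B_n would be leaves. The tree edge at 1 leads to
0 or 2, so it would be a whole component. -/
lemma graphB_not_hasHIST (hn : 5 ≤ n) : ¬HasHIST (graphB n) := by
  rintro ⟨T, hle, hT, h2⟩
  have : Nontrivial (Fin n) := Fin.nontrivial_iff_two_le.2 (by omega)
  obtain ⟨b, hb⟩ := hT.1.preconnected.exists_adj_of_nontrivial ⟨1, by omega⟩
  have n1 : T.neighborSet ⟨1, by omega⟩ ⊆ {⟨0, by omega⟩, ⟨2, by omega⟩} := fun x hx => by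
    have := graphB_adj.1 (hle hx)
    simp [Fin.ext_iff] at this ⊢
    omega
  have n0 : T.neighborSet ⟨0, by omega⟩ ⊆ {⟨1, by omega⟩, ⟨3, by omega⟩} := fun x hx => by
    have := graphB_adj.1 (hle hx)
    simp [Fin.ext_iff] at this ⊢
    omega
  have n2 : T.neighborSet ⟨2, by omega⟩ ⊆ {⟨1, by omega⟩, ⟨4, by omega⟩} := fun x hx => by
    have := graphB_adj.1 (hle hx)
    simp [Fin.ext_iff] at this ⊢
    omega
  rcases n1 hb with rfl | rfl
  · exact not_adj_of_neighborSet_subset (y := ⟨4, by omega⟩) hT.1 h2 n1 n0 (by simp) (by simp)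
      (by simp) (by simp) hb
  · exact not_adj_of_neighborSet_subset (y := ⟨3, by omega⟩) hT.1 h2 (Set.pair_comm _ _ ▸ n1) n2
      (by simp) (by simp) (by simp) (by simp) hb

/-- Rayleigh quotient of a perturbed clique vector: a small weight ε on 0 and 2 raises row 3
strictly above n - 4. Rows 0 and 2 stay good because (n - 4)ε ≤ 1, which is why ε = 1/n is chosen.
-/
lemma lt_spectralRadius_graphB (hn : 5 ≤ n) : (n : ℝ) - 4 < spectralRadius (graphB n) := by
  classical
  have hn0 : (5 : ℝ) ≤ n := by exact_mod_cast hn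
  set ε : ℝ := 1 / n with hε
  have hε0 : 0 < ε := by positivity
  have hεn : n * ε = 1 := by rw [hε]; field_simp
  let x : Fin n → ℝ := fun i => if 3 ≤ i.val then 1 else if i.val = 1 then 0 else ε
  have hx0 : ∀ i, 0 ≤ x i := fun i => by simp only [x]; split_ifs <;> positivity
  have hxK : ∀ i : Fin n, 3 ≤ i.val → x i = 1 := fun i hi => if_pos hi
  set B := graphB n with hB
  have hAx : ∀ i, (B.adjMatrix ℝ *ᵥ x) i = ∑ j ∈ B.neighborFinset i, x j := fun i =>
    adjMatrix_mulVec_apply B i x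
  have hge : ∀ i (s : Finset (Fin n)), (∀ j ∈ s, B.Adj i j) →
      ∑ j ∈ s, x j ≤ (B.adjMatrix ℝ *ᵥ x) i := by
    intro i s hs
    rw [hAx]
    exact sum_le_sum_of_subset_of_nonneg (fun j hj => by simpa using hs j hj) fun j _ _ => hx0 j
  set K : Finset (Fin n) := Finset.Ici ⟨3, by omega⟩ with hK
  have mK : ∀ j, j ∈ K ↔ 3 ≤ j.val := fun j => by rw [hK, Finset.mem_Ici, Fin.le_def]
  have hKsum : ∀ i ∈ K, ∑ j ∈ K.erase i, x j = (n : ℝ) - 4 := by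
    intro i hi
    rw [sum_congr rfl fun j hj => hxK j ((mK j).1 (mem_of_mem_erase hj)), sum_const,
      card_erase_of_mem hi, hK, Fin.card_Ici, nsmul_eq_mul, mul_one, Nat.sub_sub,
      Nat.cast_sub (by simp; omega)]
    norm_num
  have hKadj : ∀ i ∈ K, ∀ j ∈ K.erase i, B.Adj i j := by
    intro i hi j hj
    rw [mem_erase, mK, Ne, Fin.ext_iff] at hj
    rw [mK] at hi
    rw [hB, graphB_adj]
    omega
  have hcol : ∀ i, ((n : ℝ) - 4) * x i * x i ≤ x i * (B.adjMatrix ℝ *ᵥ x) i := by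
    intro i
    rw [mul_comm]
    refine mul_le_mul_of_nonneg_left ?_ (hx0 i)
    by_cases h3 : 3 ≤ i.val
    · rw [hxK i h3, mul_one, ← hKsum i ((mK i).2 h3)]
      exact hge i _ (hKadj i ((mK i).2 h3))
    · by_cases h1 : i.val = 1
      · have : x i = 0 := by simp [x, h1]
        rw [this, mul_zero, hAx]
        exact sum_nonneg fun j _ => hx0 j
      · have : x i = ε := by simp [x, h3, h1]
        have hj : ∃ j : Fin n, 3 ≤ j.val ∧ B.Adj i j := by
          by_cases h0 : i.val = 0
          · exact ⟨⟨3, by omega⟩, le_rfl, by rw [hB, graphB_adj]; simp; omega⟩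
          · exact ⟨⟨4, by omega⟩, by simp, by rw [hB, graphB_adj]; simp; omega⟩
        obtain ⟨j, hj3, hij⟩ := hj
        have h5 := hge i {j} (by simpa using hij)
        rw [sum_singleton, hxK j hj3] at h5
        rw [this]
        nlinarith
  have hcol3 : ((n : ℝ) - 4) * x ⟨3, by omega⟩ * x ⟨3, by omega⟩ <
      x ⟨3, by omega⟩ * (B.adjMatrix ℝ *ᵥ x) ⟨3, by omega⟩ := by
    have h3 : (⟨3, by omega⟩ : Fin n) ∈ K := (mK _).2 le_rfl
    have h0 : (⟨0, by omega⟩ : Fin n) ∉ K.erase ⟨3, by omega⟩ := by simp [mK]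
    have h5 := hge ⟨3, by omega⟩ (insert ⟨0, by omega⟩ (K.erase ⟨3, by omega⟩)) (by
      intro j hj
      rcases mem_insert.1 hj with rfl | hj
      · rw [hB, graphB_adj]; simp
      · exact hKadj _ h3 j hj)
    rw [sum_insert h0, hKsum _ h3] at h5
    have e0 : x ⟨0, by omega⟩ = ε := by simp [x]
    rw [hxK ⟨3, by omega⟩ le_rfl, mul_one, mul_one, one_mul]
    linarith
  have hlt : ((n : ℝ) - 4) * (x ⬝ᵥ x) < x ⬝ᵥ (B.adjMatrix ℝ *ᵥ x) := by
    simp only [dotProduct, mul_sum, ← mul_assoc]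
    exact sum_lt_sum (fun i _ => hcol i) ⟨⟨3, by omega⟩, mem_univ _, hcol3⟩
  have hpos : 0 < x ⬝ᵥ x := by
    rw [dotProduct]
    refine sum_pos' (fun i _ => mul_self_nonneg _) ⟨⟨3, by omega⟩, mem_univ _, ?_⟩
    rw [hxK ⟨3, by omega⟩ le_rfl]
    norm_num
  exact lt_of_mul_lt_mul_right (hlt.trans_le (dotProduct_mulVec_le_spectralRadius B x)) hpos.le

end GraphB

theorem IsTwoConnected.hasHIST_or_iso_of_spectralRadius_le {V : Type*} [Fintype V]
    {G : SimpleGraph V} {n : ℕ} (h8 : 8 ≤ n) (hn : Fintype.card V = n) (hG : IsTwoConnected G)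
    (hρ : spectralRadius (graphB n) ≤ spectralRadius G) :
    HasHIST G ∨ Nonempty (G ≃g graphB n) := by
  classical
  have : Nonempty V := Fintype.card_pos_iff.1 (by omega)
  refine hG.hasHIST_or_iso hn h8 ?_
  have h1 := spectralRadius_bound G hG.two_le_degree
  have h2 := (lt_spectralRadius_graphB (n := n) (by omega)).trans_le hρ
  rw [hn] at h1
  have hn' : (8 : ℝ) ≤ n := by exact_mod_cast h8
  -- Since t² - t increases beyond n - 4, (n - 4)(n - 5) < 2m - 2(n - 1).
  have h3 : (n : ℝ) * n + 18 < 2 * #G.edgeFinset + 7 * n := by nlinarith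
  -- Both sides have the same parity, so the strict bound improves from 18 to 20, exactly the edge
  -- count of B_n.
  have h4 : n * n + 18 < 2 * #G.edgeFinset + 7 * n := by exact_mod_cast h3
  have h5 : Even (n * n + n) := by rw [← Nat.mul_succ]; exact Nat.even_mul_succ_self n
  obtain ⟨k, hk⟩ := h5
  omega

end HIST

theorem theorem2 (n : ℕ) (hn : 8 ≤ n) :
    -- every 2-connected graph whose spectral radius is at least that of `B_n` has a HIST or is `B_n`
    (∀ (V : Type u) [Fintype V] (G : SimpleGraph V), Fintype.card V = n →
      HIST.IsTwoConnected G →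
      HIST.spectralRadius (HIST.graphB n) ≤ HIST.spectralRadius G →
      HIST.HasHIST G ∨ Nonempty (G ≃g HIST.graphB n)) ∧
    -- the exception is genuine
    (HIST.IsTwoConnected (HIST.graphB n) ∧ ¬ HIST.HasHIST (HIST.graphB n)) ∧
    -- `B_n` is the unique maximiser among the 2-connected graphs without a HIST
    (∀ (V : Type u) [Fintype V] (G : SimpleGraph V), Fintype.card V = n →
      HIST.IsTwoConnected G → ¬ HIST.HasHIST G →
      HIST.spectralRadius G ≤ HIST.spectralRadius (HIST.graphB n) ∧
      (HIST.spectralRadius G = HIST.spectralRadius (HIST.graphB n) ↔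
        Nonempty (G ≃g HIST.graphB n))) := by
  refine ⟨fun V _ G hV hG hρ => hG.hasHIST_or_iso_of_spectralRadius_le hn hV hρ,
    ⟨HIST.graphB_isTwoConnected (by omega), HIST.graphB_not_hasHIST (by omega)⟩, ?_⟩
  intro V _ G hV hG hno
  have : Nonempty V := Fintype.card_pos_iff.1 (by omega)
  have key : HIST.spectralRadius (HIST.graphB n) ≤ HIST.spectralRadius G →
      Nonempty (G ≃g HIST.graphB n) := fun h =>
    (hG.hasHIST_or_iso_of_spectralRadius_le hn hV h).resolve_left hno
  refine ⟨?_, fun h => key h.ge, fun ⟨e⟩ => HIST.spectralRadius_eq_of_iso e⟩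
  by_contra! h
  obtain ⟨e⟩ := key h.le
  exact h.ne' (HIST.spectralRadius_eq_of_iso e)
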